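/- Let $N\ge 1$ and $0<\sigma<2$. For $t>0$ let $P_\sigma(\cdot,t)$ be the kernel of the fractional heat equation $\partial_t u+(-\Delta)^{\sigma/2}u=0$ on $\mathbb{R}^N$, that is, the inverse Fourier transform of $\xi\mapsto e^{-t|\xi|^\sigma}$, and let $A(\cdot,t)=(-\Delta)^{\sigma/2}P_\sigma(\cdot,t)$, where $(-\Delta)^{\sigma/2}=\mathcal F^{-1}(|\xi|^\sigma\mathcal F\,\cdot\,)$ acts in the variable $x$. Write $|Y|_\sigma=(|x|^2+|t|^{2/\sigma})^{1/2}$ for $Y=(x,t)$. Then for every $t>0$ the kernel $A(\cdot,t)$ is well defined (both $P_\sigma(\cdot,t)$ and $|\xi|^\sigma\mathcal F P_\sigma(\cdot,t)$ are integrable), $A$ is real-valued and, at every point of $\mathbb{R}^N\times(0,\infty)$, differentiable in $t$ and in $x$, and there is a constant $c>0$, depending only on $N$ and $\sigma$, such that for all $Y=(x,t)\in\mathbb{R}^N\times(0,\infty)$ $$|A(Y)|\le \frac{c}{|Y|_\sigma^{N+\sigma}},\qquad |\partial_t A(Y)|\le \frac{c}{|Y|_\sigma^{N+2\sigma}},\qquad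 |\nabla_x A(Y)|\le \frac{c}{|Y|_\sigma^{N+\sigma+1}}.$$ -/

import Mathlib

open scoped FourierTransform

/-- The Fourier multiplier `F⁻¹ (|ξ|^σ F f)`, i.e. `(-Δ)^{σ/2} f`. Mathlib's Fourier transform
`∫ exp(-2πi⟨x, ξ⟩) f x dx` carries a factor `2π` in the phase, so that the symbol `|ξ|^σ` of
`(-Δ)^{σ/2}` reads `(2π|ξ|)^σ` in this normalization. -/
noncomputable def fracLaplacian {N : ℕ} (σ : ℝ) (f : EuclideanSpace ℝ (Fin N) → ℂ) :
    EuclideanSpace ℝ (Fin N) → ℂ :=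
  𝓕⁻ (fun ξ : EuclideanSpace ℝ (Fin N) => (((2 * Real.pi * ‖ξ‖) ^ σ : ℝ) : ℂ) * 𝓕 f ξ)

/-- Both integrals in the definition of `fracLaplacian σ f` (the Fourier transform of `f` and the
inverse Fourier transform of `|ξ|^σ F f`) converge absolutely. -/
def FracLaplacianConverges {N : ℕ} (σ : ℝ) (f : EuclideanSpace ℝ (Fin N) → ℂ) : Prop :=
  MeasureTheory.Integrable f ∧
    MeasureTheory.Integrable
      (fun ξ : EuclideanSpace ℝ (Fin N) => (((2 * Real.pi * ‖ξ‖) ^ σ : ℝ) : ℂ) * 𝓕 f ξ)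

/-- The kernel `P_σ(x, t)` of the fractional heat equation `∂ₜ u + (-Δ)^{σ/2} u = 0` on `ℝ^N`: the
function of `x` whose Fourier transform is `exp(-t |ξ|^σ)`. -/
noncomputable def fracHeatKernel (N : ℕ) (σ : ℝ) (x : EuclideanSpace ℝ (Fin N)) (t : ℝ) : ℂ :=
  𝓕⁻ (fun ξ : EuclideanSpace ℝ (Fin N) =>
    ((Real.exp (-(2 * Real.pi * ‖ξ‖) ^ σ * t) : ℝ) : ℂ)) x

/-- The singular kernel `A_σ = (-Δ)^{σ/2} P_σ`, the operator acting in the variable `x`. -/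
noncomputable def singularKernel (N : ℕ) (σ : ℝ) (x : EuclideanSpace ℝ (Fin N)) (t : ℝ) : ℂ :=
  fracLaplacian σ (fun y => fracHeatKernel N σ y t) x

/-- The `σ`-parabolic quasi-distance `|Y|_σ = (|x|² + |t|^{2/σ})^{1/2}` of `Y = (x, t)` to `0`. -/
noncomputable def parabolicNorm {N : ℕ} (σ : ℝ) (x : EuclideanSpace ℝ (Fin N)) (t : ℝ) : ℝ :=
  Real.sqrt (‖x‖ ^ 2 + |t| ^ (2 / σ))

/-! With symbol `|ξ|^p exp(-t|ξ|^σ)`, write `K_p` for the kernel `stableKernel N σ p t`. Fourier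
inversion turns `A` into `K_σ` (`singularKernel_eq`), and differentiation under the integral gives
`∂ₜA = -K_{2σ}`. Everything therefore reduces to bounding `K_p` by `|Y|_σ^{-(N+p)}` and its gradient
by `|Y|_σ^{-(N+p+1)}` for `p > 0`.

Where `t^{1/σ}` dominates `|x|`, the `L¹` norm of the symbol suffices: by scaling it is a constant
times `t^{-(N+p)/σ}`, and a gradient raises `p` by one.

Where `|x|` dominates, a bound uniform in `t` is needed, and it comes from Gaussian subordination.
Put `l = |ξ|²`, `q = p/2`, `a = σ/2 < 1`. The symbol `l^q exp(-t l^a)` is the Laplace transform in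
`l` of a possibly signed density `η` with `|η(s)| ≤ C s^{-(q+1)}`, where `C` does not depend on `t`
(`exists_density`). Hence `K_p` is the superposition of Gauss kernels with weight `η`, and
integrating `s^{-(q+1)}` against the Gauss kernel gives a multiple of `|x|^{-(N+2q)}`.

The density is an inverse Laplace integral along a ray of angle `θ`, with `π/2 < θ < π` and `aθ <
π/2`: the first condition makes `exp(sz)` decay, the second makes `exp(-t z^a)` decay, so that `|z^q
exp(-t z^a)| ≤ |z|^q` there for every `t`. That `η` has the right Laplace transform follows from
Fubini and a Cauchy formula on the sector between the positive axis and the ray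
(`im_integral_ray_cauchy`). -/

/-! ### Contour integrals in a sector, in the logarithmic variable. -/

section Sector

open MeasureTheory Set Filter Topology

/-- Cauchy's theorem in a horizontal strip: for a function with exponential decay, integration along
the bottom and the top edge agree in the limit. -/
theorem tendsto_integral_sub_integral_shift {f : ℂ → ℂ} {θ M L : ℝ} (hθ : 0 ≤ θ)
    (hf : DifferentiableOn ℂ f {w | w.im ∈ Icc 0 θ})
    (hb : ∀ w : ℂ, w.im ∈ Icc 0 θ → L ≤ |w.re| → ‖f w‖ ≤ M * Real.exp (-|w.re|)) :
    Tendsto (fun T : ℝ => (∫ u in -T..T, f u) - ∫ u in -T..T, f (u + θ * Complex.I))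
      atTop (𝓝 0) := by
  have hlim : Tendsto (fun T : ℝ => 2 * (M * θ) * Real.exp (-T)) atTop (𝓝 0) := by
    simpa using (Real.tendsto_exp_neg_atTop_nhds_zero).const_mul (2 * (M * θ))
  refine squeeze_zero_norm' ?_ hlim
  filter_upwards [eventually_ge_atTop (max L 0)] with T hT
  have hTL : L ≤ T := (le_max_left _ _).trans hT
  have hT0 : 0 ≤ T := (le_max_right _ _).trans hT
  have key := Complex.integral_boundary_rect_eq_zero_of_differentiableOn f (-T : ℂ)
    (T + θ * Complex.I) (hf.mono (by
      intro w hw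
      have := hw.2
      simpa [uIcc_of_le hθ] using this))
  simp only [Complex.neg_im, Complex.ofReal_im, neg_zero, Complex.ofReal_zero, zero_mul, add_zero,
    Complex.neg_re, Complex.ofReal_re, Complex.add_re, Complex.mul_re, Complex.I_re, mul_zero,
    Complex.I_im, Complex.add_im, Complex.mul_im, mul_one, zero_add, smul_eq_mul,
    Complex.ofReal_neg, sub_self] at key
  have hside : ∀ S : ℝ, |S| = T →
      ‖∫ y in (0 : ℝ)..θ, f (S + y * Complex.I)‖ ≤ M * θ * Real.exp (-T) := by
    intro S hS
    have := intervalIntegral.norm_integral_le_of_norm_le_const (a := 0) (b := θ)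
      (f := fun y : ℝ => f (S + y * Complex.I)) (C := M * Real.exp (-T)) (by
        intro y hy
        rw [uIoc_of_le hθ] at hy
        have := hb (S + y * Complex.I) (by simpa using ⟨hy.1.le, hy.2⟩) (by simpa [hS] using hTL)
        simpa [hS] using this)
    rw [sub_zero, abs_of_nonneg hθ] at this
    linarith
  have h1 := hside T (abs_of_nonneg hT0)
  have h2 := hside (-T) (by rw [abs_neg, abs_of_nonneg hT0])
  rw [show (((-T : ℝ)) : ℂ) = -(T : ℂ) by simp] at h2
  have : (∫ u in -T..T, f u) - ∫ u in -T..T, f (u + θ * Complex.I)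
      = Complex.I * (∫ y in (0 : ℝ)..θ, f (-T + y * Complex.I)) -
        Complex.I * (∫ y in (0 : ℝ)..θ, f (T + y * Complex.I)) := by
    linear_combination key
  rw [this]
  refine (norm_sub_le _ _).trans ?_
  simp only [norm_mul, Complex.norm_I, one_mul]
  linarith

theorem integrableOn_exp_smul_comp_exp (g : ℝ → ℂ) :
    Integrable (fun u => Real.exp u • g (Real.exp u)) ↔ IntegrableOn g (Ioi 0) := by
  have h := integrableOn_image_iff_integrableOn_abs_deriv_smul (s := univ) MeasurableSet.univ
    (fun x _ => (Real.hasDerivAt_exp x).hasDerivWithinAt)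
    (fun x _ y _ hxy => Real.exp_injective hxy) g
  rw [image_univ, Real.range_exp] at h
  rw [h, integrableOn_univ]
  simp [abs_of_pos (Real.exp_pos _)]

theorem integral_exp_smul_comp_exp (g : ℝ → ℂ) :
    ∫ u, Real.exp u • g (Real.exp u) = ∫ r in Ioi (0 : ℝ), g r := by
  have h := integral_image_eq_integral_abs_deriv_smul (s := univ) MeasurableSet.univ
    (fun x _ => (Real.hasDerivAt_exp x).hasDerivWithinAt)
    (fun x _ y _ hxy => Real.exp_injective hxy) g
  rw [image_univ, Real.range_exp] at h
  rw [h, Measure.restrict_univ]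
  simp [abs_of_pos (Real.exp_pos _)]

theorem im_mul_exp_mul_I_add (r m θ : ℝ) :
    ((r : ℂ) * Complex.exp (θ * Complex.I) + m).im = r * Real.sin θ := by
  simp [Complex.exp_ofReal_mul_I_im, Complex.exp_ofReal_mul_I_re]

/-- A ray that leaves the real axis stays proportionally far from real points. -/
theorem norm_ray_add_ge {θ : ℝ} (h0 : 0 < θ) (hπ : θ < Real.pi) (r m : ℝ) :
    Real.sin θ / 2 * (r + |m|) ≤ ‖(r : ℂ) * Complex.exp (θ * Complex.I) + m‖ := by
  have hs := Real.sin_pos_of_pos_of_lt_pi h0 hπ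
  have h1 : r * Real.sin θ ≤ ‖(r : ℂ) * Complex.exp (θ * Complex.I) + m‖ := by
    rw [← im_mul_exp_mul_I_add r m θ]
    exact (le_abs_self _).trans (Complex.abs_im_le_norm _)
  have h2 : |m| * Real.sin θ ≤ ‖(r : ℂ) * Complex.exp (θ * Complex.I) + m‖ := by
    have he : ‖(r : ℂ) * Complex.exp (θ * Complex.I) + m‖
        = ‖(r : ℂ) + m * Complex.exp (-θ * Complex.I)‖ := by
      have : (r : ℂ) * Complex.exp (θ * Complex.I) + m
          = ((r : ℂ) + m * Complex.exp (-θ * Complex.I)) * Complex.exp (θ * Complex.I) := by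
        rw [add_mul, mul_assoc, ← Complex.exp_add]; simp
      rw [this, norm_mul, Complex.norm_exp_ofReal_mul_I, mul_one]
    rw [he]
    refine le_trans (le_of_eq ?_) (Complex.abs_im_le_norm _)
    have : Complex.exp (-θ * Complex.I) = Complex.exp (((-θ : ℝ) : ℂ) * Complex.I) := by simp
    rw [this]
    simp [-Complex.ofReal_neg, -neg_mul, Complex.exp_ofReal_mul_I_im, Complex.exp_ofReal_mul_I_re,
      abs_mul, abs_of_pos hs]
  linarith

theorem integrableOn_inv_one_add_sq : IntegrableOn (fun r : ℝ => ((1 + r) ^ 2)⁻¹) (Ioi 0) := by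
  have h := (integrable_one_add_norm (E := ℝ) (μ := volume) (r := 2) (by simp)).integrableOn
    (s := Ioi 0)
  refine h.congr_fun (fun r hr => ?_) measurableSet_Ioi
  have hr' : (0 : ℝ) < r := hr
  simp only [Real.norm_eq_abs, abs_of_pos hr']
  rw [Real.rpow_neg (by positivity)]
  norm_num

/-- The explicit contour integral that isolates the pole of the Cauchy kernel. -/
theorem integral_ray_comparison {θ : ℝ} (h0 : 0 < θ) (hπ : θ < Real.pi) {l : ℝ} (hl : 0 < l) :
    IntegrableOn (fun r : ℝ => Complex.exp (θ * Complex.I) * ((1 + l) /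
      ((r * Complex.exp (θ * Complex.I) + 1) * (r * Complex.exp (θ * Complex.I) - l)))) (Ioi 0) ∧
    ∫ r in Ioi (0 : ℝ), Complex.exp (θ * Complex.I) * ((1 + l) /
      ((r * Complex.exp (θ * Complex.I) + 1) * (r * Complex.exp (θ * Complex.I) - l)))
      = -(Real.log l + Real.pi * Complex.I) := by
  set e := Complex.exp (θ * Complex.I) with he
  have hs := Real.sin_pos_of_pos_of_lt_pi h0 hπ
  have hlow : ∀ r : ℝ, 0 ≤ r → ∀ m : ℝ, m ≠ 0 → (r : ℂ) * e + m ≠ 0 := by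
    intro r hr m hm h
    have := norm_ray_add_ge h0 hπ r m
    rw [← he, h, norm_zero] at this
    have : 0 < Real.sin θ / 2 * (r + |m|) := by positivity
    linarith
  have hne1 : ∀ r : ℝ, 0 ≤ r → (r : ℂ) * e + 1 ≠ 0 := fun r hr => by
    simpa using hlow r hr 1 one_ne_zero
  have hnel : ∀ r : ℝ, 0 ≤ r → (r : ℂ) * e - l ≠ 0 := fun r hr => by
    simpa [sub_eq_add_neg] using hlow r hr (-l) (by linarith)
  have hint : IntegrableOn (fun r : ℝ => e * ((1 + l) / ((r * e + 1) * (r * e - l)))) (Ioi 0) := by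
    refine Integrable.mono' (integrableOn_inv_one_add_sq.const_mul
      ((1 + l) * (2 / Real.sin θ) ^ 2 * (1 + 1 / l))) ?_ ?_
    · refine ContinuousOn.aestronglyMeasurable (fun r hr => ContinuousAt.continuousWithinAt ?_)
        measurableSet_Ioi
      have := mul_ne_zero (hne1 r (le_of_lt hr)) (hnel r (le_of_lt hr))
      fun_prop (disch := assumption)
    · refine (ae_restrict_iff' measurableSet_Ioi).2 (Eventually.of_forall fun r hr => ?_)
      have hr' : (0 : ℝ) < r := hr
      have h1 := norm_ray_add_ge h0 hπ r 1
      have h2 := norm_ray_add_ge h0 hπ r (-l)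
      rw [← he] at h1 h2
      simp only [Complex.ofReal_one, abs_one, Complex.ofReal_neg, ← sub_eq_add_neg, abs_neg,
        abs_of_pos hl] at h1 h2
      have hn : ‖(1 + l : ℂ)‖ = 1 + l := by
        rw [show (1 + l : ℂ) = ((1 + l : ℝ) : ℂ) by push_cast; rfl, Complex.norm_real,
          Real.norm_of_nonneg (by positivity)]
      rw [norm_mul, norm_div, norm_mul, hn, he, Complex.norm_exp_ofReal_mul_I, one_mul, ← he]
      have h3 : 1 + r ≤ (1 + 1 / l) * (r + l) := by
        have : (1 + 1 / l) * (r + l) = 1 + r + (r / l + l) := by field_simp; ring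
        rw [this]; have : 0 < r / l + l := by positivity
        linarith
      calc (1 + l) / (‖(r : ℂ) * e + 1‖ * ‖(r : ℂ) * e - l‖)
          ≤ (1 + l) / ((Real.sin θ / 2 * (r + 1)) * (Real.sin θ / 2 * (r + l))) := by gcongr
        _ = (1 + l) * (2 / Real.sin θ) ^ 2 * (1 / ((r + 1) * (r + l))) := by field_simp
        _ ≤ (1 + l) * (2 / Real.sin θ) ^ 2 * ((1 + 1 / l) * ((1 + r) ^ 2)⁻¹) := by
            gcongr
            rw [div_le_iff₀ (by positivity)]
            calc (1:ℝ) = ((1 + r) ^ 2)⁻¹ * ((1 + r) * (1 + r)) := by field_simp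
              _ ≤ ((1 + r) ^ 2)⁻¹ * ((1 + r) * ((1 + 1 / l) * (r + l))) := by gcongr
              _ = _ := by ring
        _ = _ := by ring
  refine ⟨hint, ?_⟩
  have hslit : ∀ r : ℝ, 0 < r → ∀ m : ℝ, (r : ℂ) * e + m ∈ Complex.slitPlane := by
    intro r hr m
    refine Complex.mem_slitPlane_iff.2 (Or.inr ?_)
    rw [he, im_mul_exp_mul_I_add]
    exact (mul_pos hr hs).ne'
  -- Partial fractions give a logarithmic antiderivative. It vanishes at infinity, so the integral
  -- is minus its value at `r = 0`.
  have hder : ∀ r ∈ Ioi (0 : ℝ), HasDerivAt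
      (fun r : ℝ => Complex.log (r * e - l) - Complex.log (r * e + 1))
      (e * ((1 + l) / ((r * e + 1) * (r * e - l)))) r := by
    intro r hr
    have hr' : (0 : ℝ) < r := hr
    have ha : HasDerivAt (fun r : ℝ => (r : ℂ) * e) e r := by
      simpa using (Complex.ofRealCLM.hasDerivAt (x := r)).mul_const e
    have h1 := (ha.sub_const (l : ℂ)).clog_real (by simpa [sub_eq_add_neg] using hslit r hr (-l))
    have h2 := (ha.add_const (1 : ℂ)).clog_real (by simpa using hslit r hr 1)
    convert! h1.sub h2 using 1
    rw [div_sub_div _ _ (hnel r hr'.le) (hne1 r hr'.le), mul_div_assoc',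
      mul_comm ((r : ℂ) * e + 1)]
    ring
  have hcont : ContinuousWithinAt
      (fun r : ℝ => Complex.log (r * e - l) - Complex.log (r * e + 1)) (Ici 0) 0 := by
    refine ContinuousWithinAt.sub ?_ ?_
    -- The point `-l` lies on the branch cut, but the ray reaches it from above, where the principal
    -- logarithm is continuous. This one-sided limit produces the term `πi`.
    · have h1 : ContinuousWithinAt Complex.log {z : ℂ | 0 ≤ z.im} (((0 : ℝ) : ℂ) * e - l) := by
        apply Complex.continuousWithinAt_log_of_re_neg_of_im_zero <;> simp [hl]
      refine ContinuousWithinAt.comp (f := fun r : ℝ => (r : ℂ) * e - l) h1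
        (by fun_prop) (fun r hr => ?_)
      have := im_mul_exp_mul_I_add r (-l) θ
      rw [← he, Complex.ofReal_neg, ← sub_eq_add_neg] at this
      simp only [mem_ofPred_eq, this]
      exact mul_nonneg hr hs.le
    · refine ContinuousAt.continuousWithinAt ?_
      refine ContinuousAt.clog (by fun_prop) ?_
      simp
  have hinf : Tendsto (fun r : ℝ => Complex.log (r * e - l) - Complex.log (r * e + 1)) atTop
      (𝓝 0) := by
    -- Factoring out `r` exposes the same divergent `log r` in both logarithms, so it cancels in the
    -- difference.
    have heq : ∀ m : ℝ, ∀ r : ℝ, 0 < r →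
        Complex.log (r * e + m) = Real.log r + Complex.log (e + m / r) := by
      intro m r hr
      have hrc : (r : ℂ) ≠ 0 := by exact_mod_cast hr.ne'
      have h : (r : ℂ) * e + m = r * (e + m / r) := by field_simp
      rw [h, Complex.log_ofReal_mul hr]
      intro h'
      rw [h', mul_zero] at h
      exact Complex.slitPlane_ne_zero (hslit r hr m) h
    have hes : e ∈ Complex.slitPlane := by simpa using hslit 1 one_pos 0
    have hl' : ∀ m : ℝ, Tendsto (fun r : ℝ => Complex.log (e + m / r)) atTop
        (𝓝 (Complex.log e)) := by
      intro m
      refine Tendsto.clog ?_ hes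
      have : Tendsto (fun r : ℝ => ((m / r : ℝ) : ℂ)) atTop (𝓝 ((0 : ℝ) : ℂ)) :=
        (Complex.continuous_ofReal.tendsto _).comp (tendsto_const_nhds.div_atTop tendsto_id)
      simpa using this.const_add e
    have := (hl' (-l)).sub (hl' 1)
    rw [sub_self] at this
    refine this.congr' ?_
    filter_upwards [eventually_gt_atTop 0] with r hr
    have h1 := heq (-l) r hr
    have h2 := heq 1 r hr
    simp only [Complex.ofReal_neg, Complex.ofReal_one, ← sub_eq_add_neg] at h1 h2 ⊢
    rw [h1, h2]; ring
  rw [integral_Ioi_of_hasDerivAt_of_tendsto hcont hder hint hinf]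
  have : Complex.log (-(l : ℂ)) = Real.log l + Real.pi * Complex.I := by
    have h := Complex.log_ofReal_mul hl (x := -1) (by simp)
    rw [Complex.log_neg_one] at h
    simpa using h
  simp [this]

end Sector

/-! ### A Cauchy formula on the sector. -/

section Cauchy

open MeasureTheory Set Filter Topology

theorem continuousOn_comp_log_ray {G : ℂ → ℂ} (hG : Continuous G) (θ : ℝ) :
    ContinuousOn (fun r : ℝ => G (Real.log r + θ * Complex.I)) (Ioi 0) := by
  refine hG.comp_continuousOn (ContinuousOn.add ?_ continuousOn_const)
  exact Complex.continuous_ofReal.comp_continuousOn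
    (Real.continuousOn_log.mono fun r hr => (ne_of_gt hr : r ≠ 0))

theorem norm_comp_log_ray_le {G : ℂ → ℂ} {θ D : ℝ} (h0 : 0 ≤ θ)
    (hD : ∀ w : ℂ, w.im ∈ Icc 0 θ → ‖G w‖ * (1 + Real.exp w.re) ^ 2 ≤ D) {r : ℝ} (hr : 0 < r) :
    ‖G (Real.log r + θ * Complex.I)‖ ≤ D * ((1 + r) ^ 2)⁻¹ := by
  have := hD (Real.log r + θ * Complex.I) (by simpa using h0)
  simp only [Complex.add_re, Complex.ofReal_re, Complex.mul_re, Complex.I_re, mul_zero,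
    Complex.ofReal_im, Complex.I_im, mul_one, sub_self, add_zero, Real.exp_log hr] at this
  rw [← div_eq_mul_inv, le_div_iff₀ (by positivity)]
  exact this

theorem integrableOn_comp_log_ray {G : ℂ → ℂ} {θ D : ℝ} (h0 : 0 ≤ θ) (hG : Continuous G)
    (hD : ∀ w : ℂ, w.im ∈ Icc 0 θ → ‖G w‖ * (1 + Real.exp w.re) ^ 2 ≤ D) :
    IntegrableOn (fun r : ℝ => G (Real.log r + θ * Complex.I)) (Ioi 0) := by
  refine Integrable.mono' (integrableOn_inv_one_add_sq.const_mul D)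
    ((continuousOn_comp_log_ray hG θ).aestronglyMeasurable measurableSet_Ioi) ?_
  exact (ae_restrict_iff' measurableSet_Ioi).2
    (Eventually.of_forall fun r hr => norm_comp_log_ray_le h0 hD hr)

theorem integrableOn_ray_cauchy {G : ℂ → ℂ} {θ D : ℝ} (h0 : 0 < θ) (hπ : θ < Real.pi)
    (hG : Continuous G)
    (hD : ∀ w : ℂ, w.im ∈ Icc 0 θ → ‖G w‖ * (1 + Real.exp w.re) ^ 2 ≤ D) {l : ℝ} (hl : 0 < l) :
    IntegrableOn (fun r : ℝ => Complex.exp (θ * Complex.I) *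
      (G (Real.log r + θ * Complex.I) / (r * Complex.exp (θ * Complex.I) - l))) (Ioi 0) := by
  have hs := Real.sin_pos_of_pos_of_lt_pi h0 hπ
  have hlow : ∀ r : ℝ, 0 < r →
      Real.sin θ / 2 * l ≤ ‖(r : ℂ) * Complex.exp (θ * Complex.I) - l‖ := by
    intro r hr
    have := norm_ray_add_ge h0 hπ r (-l)
    rw [abs_neg, abs_of_pos hl, Complex.ofReal_neg, ← sub_eq_add_neg] at this
    refine le_trans ?_ this
    gcongr
    linarith
  have hmeas : ContinuousOn (fun r : ℝ => Complex.exp (θ * Complex.I) *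
      (G (Real.log r + θ * Complex.I) / (r * Complex.exp (θ * Complex.I) - l))) (Ioi 0) := by
    refine continuousOn_const.mul ((continuousOn_comp_log_ray hG θ).div (by fun_prop) ?_)
    intro r hr h
    have := hlow r hr
    rw [h, norm_zero] at this
    have : 0 < Real.sin θ / 2 * l := by positivity
    linarith
  refine Integrable.mono' ((integrableOn_comp_log_ray h0.le hG hD).norm.const_mul
    (Real.sin θ / 2 * l)⁻¹) (hmeas.aestronglyMeasurable measurableSet_Ioi) ?_
  refine (ae_restrict_iff' measurableSet_Ioi).2 (Eventually.of_forall fun r hr => ?_)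
  rw [norm_mul, Complex.norm_exp_ofReal_mul_I, one_mul, norm_div, div_eq_mul_inv, mul_comm]
  have := hlow r hr
  gcongr

/-- Cauchy's integral formula on half a sector: for `G` real on the real axis, the imaginary part
of the Cauchy integral along the ray of angle `θ` gives the value of `G` on the axis. Here `G` is
written in the logarithmic variable. -/
theorem im_integral_ray_cauchy {G : ℂ → ℂ} {θ D : ℝ} (h0 : 0 < θ) (hπ : θ < Real.pi)
    (hG : Differentiable ℂ G) (hreal : ∀ u : ℝ, (G u).im = 0)
    (hD : ∀ w : ℂ, w.im ∈ Icc 0 θ → ‖G w‖ * (1 + Real.exp w.re) ^ 2 ≤ D) (b : ℝ) :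
    (∫ r in Ioi (0 : ℝ), Complex.exp (θ * Complex.I) * (G (Real.log r + θ * Complex.I) /
      (r * Complex.exp (θ * Complex.I) - Real.exp b))).im = -(Real.pi * (G b).re) := by
  set e := Complex.exp (θ * Complex.I) with he
  set l := Real.exp b with hl
  have hl0 : 0 < l := Real.exp_pos b
  have hlc : Complex.exp b = (l : ℂ) := by rw [hl]; push_cast; rfl
  have hInt := integrableOn_ray_cauchy h0 hπ hG.continuous hD hl0
  obtain ⟨hCint, hC⟩ := integral_ray_comparison h0 hπ hl0
  rw [← he] at hInt hCint hC
  -- The pole lies on the boundary of the sector. To avoid principal values, the explicit kernel `(1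
  -- + l) / ((z + 1)(z - l))`, which has the same residue at `z = l`, is subtracted with weight `G
  -- b`; `g` is the resulting numerator over the common denominator.
  set g : ℂ → ℂ := fun w => G w * (1 + Complex.exp w) - G b * (1 + l) with hg
  have hgd : Differentiable ℂ g := by fun_prop
  have hgb : g b = 0 := by simp [hg, hlc]
  -- A quotient of `dslope`s fills in the removable singularity at `b`. The factor `exp w` is the
  -- Jacobian of `z = exp w`.
  set f : ℂ → ℂ := fun w => Complex.exp w / (1 + Complex.exp w) *
    (dslope g b w / dslope Complex.exp b w) with hf
  have hfw : ∀ w : ℂ, w ≠ b → Complex.exp w ≠ l →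
      f w = Complex.exp w / (1 + Complex.exp w) * (g w / (Complex.exp w - l)) := by
    intro w hw hw'
    simp only [hf]
    rw [dslope_of_ne _ hw, dslope_of_ne _ hw, slope_def_field, slope_def_field, hgb, sub_zero,
      hlc, div_div_div_cancel_right₀ (sub_ne_zero.2 hw)]
  have hinj : ∀ w : ℂ, w.im ∈ Icc 0 θ → w ≠ b → Complex.exp w ≠ l := by
    intro w hw hwb h
    refine hwb (Complex.exp_inj_of_neg_pi_lt_of_le_pi ?_ ?_ ?_ ?_ (h.trans hlc.symm))
    · linarith [hw.1, Real.pi_pos]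
    · linarith [hw.2]
    · simpa using Real.pi_pos
    · simpa using Real.pi_pos.le
  have hone : ∀ w : ℂ, w.im ∈ Icc 0 θ → 1 + Complex.exp w ≠ 0 := by
    intro w hw h
    have h' : Complex.exp w = Complex.exp (Real.pi * Complex.I) := by
      rw [Complex.exp_pi_mul_I]; linear_combination h
    have := Complex.exp_inj_of_neg_pi_lt_of_le_pi (by linarith [hw.1, Real.pi_pos])
      (by linarith [hw.2]) (by simp; linarith [Real.pi_pos]) (by simp) h'
    rw [this] at hw
    have := hw.2
    simp at this
    linarith
  have hdd : ∀ h : ℂ → ℂ, Differentiable ℂ h → Differentiable ℂ (dslope h b) := by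
    intro h hh
    rw [← differentiableOn_univ] at hh ⊢
    exact (Complex.differentiableOn_dslope univ_mem).2 hh
  have hfd : DifferentiableOn ℂ f {w | w.im ∈ Icc 0 θ} := by
    intro w hw
    refine DifferentiableAt.differentiableWithinAt ?_
    have hden : dslope Complex.exp b w ≠ 0 := by
      by_cases hwb : w = b
      · rw [hwb, dslope_same, Complex.deriv_exp]; exact Complex.exp_ne_zero _
      · rw [dslope_of_ne _ hwb, slope_def_field, hlc]
        exact div_ne_zero (sub_ne_zero.2 (hinj w hw hwb)) (sub_ne_zero.2 hwb)
    have h1 := hone w hw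
    have h2 := (hdd g hgd).differentiableAt (x := w)
    have h3 := (hdd Complex.exp Complex.differentiable_exp).differentiableAt (x := w)
    have h4 : DifferentiableAt ℂ (fun w => Complex.exp w / (1 + Complex.exp w)) w := by
      fun_prop (disch := assumption)
    exact h4.fun_mul (h2.fun_div h3 hden)
  have hGn : ∀ w : ℂ, w.im ∈ Icc 0 θ → ‖G w‖ * (1 + Real.exp w.re) ≤ D := by
    intro w hw
    refine le_trans ?_ (hD w hw)
    have : 0 ≤ ‖G w‖ := norm_nonneg _
    have := Real.exp_pos w.re
    gcongr
    nlinarith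
  have hGn' : ∀ w : ℂ, w.im ∈ Icc 0 θ → ‖G w‖ ≤ D := by
    intro w hw
    refine le_trans ?_ (hGn w hw)
    have : 0 ≤ ‖G w‖ := norm_nonneg _
    have := Real.exp_pos w.re
    nlinarith
  have hD0 : 0 ≤ D := (norm_nonneg _).trans (hGn' b (by simpa using h0.le))
  have hgn : ∀ w : ℂ, w.im ∈ Icc 0 θ → ‖g w‖ ≤ D * (2 + l) := by
    intro w hw
    have h1 : ‖1 + Complex.exp w‖ ≤ 1 + Real.exp w.re := by
      refine (norm_add_le _ _).trans ?_
      rw [norm_one, Complex.norm_exp]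
    have h2 : ‖(1 + l : ℂ)‖ ≤ 1 + l := by
      refine (norm_add_le _ _).trans ?_
      rw [norm_one, Complex.norm_real, Real.norm_of_nonneg hl0.le]
    have h3 := hGn' b (by simpa using h0.le)
    calc ‖g w‖ ≤ ‖G w‖ * ‖1 + Complex.exp w‖ + ‖G b‖ * ‖(1 + l : ℂ)‖ := by
          refine (norm_sub_le _ _).trans ?_
          rw [norm_mul, norm_mul]
      _ ≤ ‖G w‖ * (1 + Real.exp w.re) + D * (1 + l) := by
          gcongr
      _ ≤ D + D * (1 + l) := by gcongr; exact hGn w hw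
      _ = _ := by ring
  -- decay of `f` at both ends of the strip
  have hfb : ∀ w : ℂ, w.im ∈ Icc 0 θ → Real.log 2 + |b| + 1 ≤ |w.re| →
      ‖f w‖ ≤ (4 * D * (2 + l) * (1 + 1 / l)) * Real.exp (-|w.re|) := by
    intro w hw hre
    have hlog2 : 0 < Real.log 2 := Real.log_pos one_lt_two
    have hwb : w ≠ b := by
      rintro rfl
      simp at hre; linarith
    have hb1 := le_abs_self b
    have hb2 := neg_abs_le b
    rw [hfw w hwb (hinj w hw hwb), norm_mul, norm_div, norm_div, Complex.norm_exp]
    set ρ := Real.exp w.re with hρ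
    have hρ0 : 0 < ρ := Real.exp_pos _
    have hgw := hgn w hw
    have hn1 : |1 - ρ| ≤ ‖1 + Complex.exp w‖ := by
      have := abs_norm_sub_norm_le (1 : ℂ) (-Complex.exp w)
      rwa [norm_one, norm_neg, Complex.norm_exp, sub_neg_eq_add] at this
    have hn2 : |ρ - l| ≤ ‖Complex.exp w - l‖ := by
      have := abs_norm_sub_norm_le (Complex.exp w) (l : ℂ)
      rwa [Complex.norm_exp, Complex.norm_real, Real.norm_of_nonneg hl0.le] at this
    have hl1 : 0 < 1 / l := by positivity
    rcases le_total 0 w.re with hp | hp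
    · rw [abs_of_nonneg hp] at hre ⊢
      have h2 : 2 ≤ ρ := by
        rw [hρ, ← Real.log_le_iff_le_exp (by norm_num)]; linarith [abs_nonneg b]
      have h3 : 2 * l ≤ ρ := by
        rw [hρ, hl, ← Real.exp_log (show (0 : ℝ) < 2 by norm_num), ← Real.exp_add]
        exact Real.exp_le_exp.2 (by linarith)
      have h4 : ρ / 2 ≤ ‖1 + Complex.exp w‖ := le_trans (by
        rw [abs_sub_comm]; exact le_trans (by linarith) (le_abs_self _)) hn1
      have h5 : ρ / 2 ≤ ‖Complex.exp w - l‖ :=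
        le_trans (le_trans (by linarith) (le_abs_self _)) hn2
      rw [Real.exp_neg, ← hρ]
      calc ρ / ‖1 + Complex.exp w‖ * (‖g w‖ / ‖Complex.exp w - l‖)
          ≤ ρ / (ρ / 2) * (D * (2 + l) / (ρ / 2)) := by gcongr
        _ = 4 * D * (2 + l) * 1 * ρ⁻¹ := by field_simp; ring
        _ ≤ _ := by gcongr; linarith
    · rw [abs_of_nonpos hp] at hre ⊢
      have h2 : ρ ≤ 1 / 2 := by
        rw [hρ, ← Real.le_log_iff_exp_le (by norm_num), one_div, Real.log_inv]
        linarith [abs_nonneg b]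
      have h3 : 2 * ρ ≤ l := by
        rw [hρ, hl, ← Real.exp_log (show (0 : ℝ) < 2 by norm_num), ← Real.exp_add]
        exact Real.exp_le_exp.2 (by linarith)
      have h4 : 1 / 2 ≤ ‖1 + Complex.exp w‖ :=
        le_trans (le_trans (by linarith) (le_abs_self _)) hn1
      have h5 : l / 2 ≤ ‖Complex.exp w - l‖ := le_trans (by
        rw [abs_sub_comm]; exact le_trans (by linarith) (le_abs_self _)) hn2
      rw [neg_neg, ← hρ]
      calc ρ / ‖1 + Complex.exp w‖ * (‖g w‖ / ‖Complex.exp w - l‖)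
          ≤ ρ / (1 / 2) * (D * (2 + l) / (l / 2)) := by gcongr
        _ = 4 * D * (2 + l) * (1 / l) * ρ := by field_simp; ring
        _ ≤ _ := by gcongr; linarith
  have hshift := tendsto_integral_sub_integral_shift h0.le hfd hfb
  -- `f` is real on the real axis
  have hfreal : ∀ T : ℝ, (∫ u in -T..T, f (u : ℂ)).im = 0 := by
    intro T
    have hcongr : (∫ u in -T..T, f (u : ℂ)) = ∫ u in -T..T, (((f (u : ℂ)).re : ℝ) : ℂ) := by
      refine intervalIntegral.integral_congr_ae ?_
      have : ∀ᵐ u : ℝ, u ≠ b := by simp [ae_iff]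
      filter_upwards [this] with u hu _
      have hub : (u : ℂ) ≠ b := by exact_mod_cast hu
      have hGr : ∀ v : ℝ, G v = ((G v).re : ℂ) := fun v =>
        Complex.ext (by simp) (by simp [hreal v])
      have : f u = ((Real.exp u / (1 + Real.exp u) * (((G u).re * (1 + Real.exp u)
          - (G b).re * (1 + l)) / (Real.exp u - l)) : ℝ) : ℂ) := by
        rw [hfw u hub (hinj u (by simpa using h0.le) hub)]
        simp only [hg]
        rw [hGr u, hGr b]
        push_cast
        rfl
      rw [this, Complex.ofReal_re]
    rw [hcongr, intervalIntegral.integral_ofReal, Complex.ofReal_im]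
  -- the shifted integral in the variable `r = exp u`
  set φ : ℝ → ℂ := fun r => e * (G (Real.log r + θ * Complex.I) / (r * e - l))
    - G b * (e * ((1 + l) / ((r * e + 1) * (r * e - l)))) with hφ
  have hφint : IntegrableOn φ (Ioi 0) := hInt.sub (hCint.const_mul _)
  have hfφ : ∀ u : ℝ, f (u + θ * Complex.I) = Real.exp u • φ (Real.exp u) := by
    intro u
    have hmem : ((u : ℂ) + θ * Complex.I).im ∈ Icc 0 θ := by simpa using h0.le
    have hwb : (u : ℂ) + θ * Complex.I ≠ b := by
      intro h
      have := congrArg Complex.im h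
      simp at this
      exact h0.ne' this
    have hexp : Complex.exp (u + θ * Complex.I) = Real.exp u * e := by
      rw [Complex.exp_add, he]; push_cast; rfl
    have h1 := hone _ hmem
    have h2 := sub_ne_zero.2 (hinj _ hmem hwb)
    rw [hfw _ hwb (hinj _ hmem hwb)]
    simp only [hφ, hg, Real.log_exp, Complex.real_smul]
    rw [hexp] at h1 h2 ⊢
    rw [add_comm] at h1
    rw [add_comm (1 : ℂ) ((Real.exp u : ℂ) * e)]
    generalize ((Real.exp u : ℝ) : ℂ) = x at *
    generalize G (u + θ * Complex.I) = y
    field_simp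
  have hlim : Tendsto (fun T : ℝ => ∫ u in -T..T, f (u + θ * Complex.I)) atTop
      (𝓝 (∫ r in Ioi (0 : ℝ), φ r)) := by
    simp_rw [hfφ]
    rw [← integral_exp_smul_comp_exp]
    exact intervalIntegral_tendsto_integral ((integrableOn_exp_smul_comp_exp φ).2 hφint)
      tendsto_neg_atTop_atBot tendsto_id
  -- The regularized integral over the ray equals the one over the real axis, where the integrand is
  -- real. The imaginary part of the original integral thus comes only from the comparison kernel.
  have hIm : (∫ r in Ioi (0 : ℝ), φ r).im = 0 := by
    have h1 := (Complex.continuous_im.tendsto _).comp hshift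
    have h2 := (Complex.continuous_im.tendsto _).comp hlim
    have h3 : Tendsto (fun T : ℝ => (∫ u in -T..T, f (u + θ * Complex.I)).im) atTop (𝓝 0) := by
      have := h1.neg
      simpa [Function.comp_def, hfreal] using this
    exact tendsto_nhds_unique h2 h3
  have hsplit : ∫ r in Ioi (0 : ℝ), φ r
      = (∫ r in Ioi (0 : ℝ), e * (G (Real.log r + θ * Complex.I) / (r * e - l)))
        - G b * -(Real.log l + Real.pi * Complex.I) := by
    rw [← hC, ← integral_const_mul, ← integral_sub hInt (hCint.const_mul _)]
  rw [hsplit] at hIm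
  simp [hreal b] at hIm
  linarith

end Cauchy

/-! ### Inverse Laplace transforms along a ray. -/

section Laplace

open MeasureTheory Set Filter Topology

/-- The inverse Laplace transform of `G ∘ log`, as an integral along the ray of angle `θ`. -/
noncomputable def rayDensity (G : ℂ → ℂ) (θ s : ℝ) : ℝ :=
  Real.pi⁻¹ * (∫ r in Ioi (0 : ℝ), Complex.exp (s * Complex.exp (θ * Complex.I) * r) *
    (G (Real.log r + θ * Complex.I) * Complex.exp (θ * Complex.I))).im

theorem norm_exp_ray (s θ r : ℝ) :
    ‖Complex.exp (s * Complex.exp (θ * Complex.I) * r)‖ = Real.exp (s * Real.cos θ * r) := by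
  rw [Complex.norm_exp]
  congr 1
  simp [Complex.exp_ofReal_mul_I_re]

theorem measurable_rayIntegrand {G : ℂ → ℂ} (hG : Continuous G) (θ : ℝ) :
    Measurable (fun q : ℝ × ℝ => Complex.exp (q.1 * Complex.exp (θ * Complex.I) * q.2) *
      (G (Real.log q.2 + θ * Complex.I) * Complex.exp (θ * Complex.I))) := by
  have h1 : Measurable (fun q : ℝ × ℝ => G (Real.log q.2 + θ * Complex.I)) :=
    hG.measurable.comp (by fun_prop)
  fun_prop

theorem measurable_rayDensity {G : ℂ → ℂ} (hG : Continuous G) (θ : ℝ) :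
    Measurable (rayDensity G θ) := by
  have h := (measurable_rayIntegrand hG θ).stronglyMeasurable.integral_prod_right'
    (ν := volume.restrict (Ioi (0 : ℝ)))
  exact (Complex.measurable_im.comp h.measurable).const_mul _

/-- The exponential factor is at most one on the ray. This controls the density near `s = 0`, where
the power bound is not integrable. -/
theorem abs_rayDensity_le_const {G : ℂ → ℂ} {θ : ℝ} (hcos : Real.cos θ < 0)
    (hint : IntegrableOn (fun r : ℝ => G (Real.log r + θ * Complex.I)) (Ioi 0))
    {s : ℝ} (hs : 0 ≤ s) :
    |rayDensity G θ s| ≤ Real.pi⁻¹ * ∫ r in Ioi (0 : ℝ), ‖G (Real.log r + θ * Complex.I)‖ := by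
  rw [rayDensity, abs_mul, abs_of_pos (inv_pos.2 Real.pi_pos)]
  refine mul_le_mul_of_nonneg_left ((Complex.abs_im_le_norm _).trans
    (norm_integral_le_of_norm_le hint.norm ?_)) (inv_pos.2 Real.pi_pos).le
  refine (ae_restrict_iff' measurableSet_Ioi).2 (Eventually.of_forall fun r hr => ?_)
  rw [norm_mul, norm_exp_ray, norm_mul, Complex.norm_exp_ofReal_mul_I, mul_one]
  refine mul_le_of_le_one_left (norm_nonneg _) (Real.exp_le_one_iff.2 ?_)
  have hr' : (0 : ℝ) < r := hr
  nlinarith [mul_nonneg hs hr'.le]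

/-- A real constant `h₀` contributes `-h₀ / s` to the ray integral, which is real and disappears
from the imaginary part. The remainder is `O(r ^ b)`, and integrating it against `exp(s cos θ r)` is
a Gamma integral. Subtracting `h₀` matters for symbols that do not vanish at the origin. -/
theorem abs_rayDensity_le_rpow {G : ℂ → ℂ} {θ : ℝ} (hcos : Real.cos θ < 0) (hG : Continuous G)
    {h₀ K b : ℝ} (hb : 0 < b)
    (hK : ∀ r : ℝ, 0 < r → ‖G (Real.log r + θ * Complex.I) - h₀‖ ≤ K * r ^ b)
    {s : ℝ} (hs : 0 < s) :
    |rayDensity G θ s| ≤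
      Real.pi⁻¹ * (K * ((-Real.cos θ) ^ (-(b + 1)) * Real.Gamma (b + 1))) * s ^ (-(b + 1)) := by
  set e := Complex.exp (θ * Complex.I) with he
  have hre : ((s : ℂ) * e).re < 0 := by
    simp [he, Complex.exp_ofReal_mul_I_re]
    nlinarith
  have hsc : 0 < s * -Real.cos θ := mul_pos hs (by linarith)
  have hΓint : IntegrableOn (fun r : ℝ => K * (r ^ b * Real.exp (-(s * -Real.cos θ) * r)))
      (Ioi 0) := by
    have := integrableOn_rpow_mul_exp_neg_mul_rpow (s := b) (p := 1) (by linarith) one_pos hsc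
    simp only [Real.rpow_one] at this
    exact this.const_mul K
  have hbound : ∀ᵐ r : ℝ ∂(volume.restrict (Ioi (0 : ℝ))),
      ‖Complex.exp (s * e * r) * ((G (Real.log r + θ * Complex.I) - h₀) * e)‖
        ≤ K * (r ^ b * Real.exp (-(s * -Real.cos θ) * r)) := by
    refine (ae_restrict_iff' measurableSet_Ioi).2 (Eventually.of_forall fun r hr => ?_)
    rw [norm_mul, he, norm_exp_ray, norm_mul, Complex.norm_exp_ofReal_mul_I, mul_one]
    have := hK r hr
    calc _ ≤ Real.exp (s * Real.cos θ * r) * (K * r ^ b) := by gcongr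
      _ = _ := by rw [show -(s * -Real.cos θ) * r = s * Real.cos θ * r by ring]; ring
  have hint1 : IntegrableOn (fun r : ℝ => Complex.exp (s * e * r) *
      ((G (Real.log r + θ * Complex.I) - h₀) * e)) (Ioi 0) := by
    refine Integrable.mono' hΓint ?_ hbound
    refine ContinuousOn.aestronglyMeasurable ?_ measurableSet_Ioi
    exact (Continuous.continuousOn (by fun_prop)).mul
      (((continuousOn_comp_log_ray hG θ).sub continuousOn_const).mul continuousOn_const)
  have hint2 : IntegrableOn (fun r : ℝ => Complex.exp (s * e * r)) (Ioi 0) :=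
    integrableOn_exp_mul_complex_Ioi hre 0
  have hsplit : (∫ r in Ioi (0 : ℝ), Complex.exp (s * e * r) *
        (G (Real.log r + θ * Complex.I) * e))
      = (∫ r in Ioi (0 : ℝ), Complex.exp (s * e * r) *
        ((G (Real.log r + θ * Complex.I) - h₀) * e)) - ((h₀ / s : ℝ) : ℂ) := by
    have h2 : ∫ r in Ioi (0 : ℝ), Complex.exp (s * e * r) * (h₀ * e) = -((h₀ / s : ℝ) : ℂ) := by
      rw [integral_mul_const, integral_exp_mul_complex_Ioi hre]
      have : e ≠ 0 := Complex.exp_ne_zero _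
      have : (s : ℂ) ≠ 0 := by exact_mod_cast hs.ne'
      simp
      field_simp
    rw [sub_eq_add_neg, ← h2, ← integral_add hint1 (hint2.mul_const _)]
    congr 1; ext r; ring
  rw [rayDensity, ← he, hsplit, Complex.sub_im, Complex.ofReal_im, sub_zero, abs_mul,
    abs_of_pos (inv_pos.2 Real.pi_pos), mul_assoc]
  refine mul_le_mul_of_nonneg_left ((Complex.abs_im_le_norm _).trans
    ((norm_integral_le_of_norm_le hΓint hbound).trans (le_of_eq ?_))) (inv_pos.2 Real.pi_pos).le
  rw [integral_const_mul]
  have := Real.integral_rpow_mul_exp_neg_mul_Ioi (a := b + 1) (by linarith) hsc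
  simp only [add_sub_cancel_right] at this
  simp only [neg_mul _ (_ : ℝ)] at this ⊢
  rw [this, one_div, Real.inv_rpow hsc.le, ← Real.rpow_neg hsc.le,
    Real.mul_rpow hs.le (by linarith)]
  ring

theorem integrableOn_rayDensity {G : ℂ → ℂ} {θ : ℝ} (hcos : Real.cos θ < 0) (hG : Continuous G)
    (hint : IntegrableOn (fun r : ℝ => G (Real.log r + θ * Complex.I)) (Ioi 0))
    {h₀ K b : ℝ} (hb : 0 < b)
    (hK : ∀ r : ℝ, 0 < r → ‖G (Real.log r + θ * Complex.I) - h₀‖ ≤ K * r ^ b) :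
    IntegrableOn (rayDensity G θ) (Ioi 0) := by
  rw [← Ioc_union_Ioi_eq_Ioi zero_le_one]
  refine IntegrableOn.union ?_ ?_
  · refine Measure.integrableOn_of_bounded (by simp)
      (measurable_rayDensity hG θ).aestronglyMeasurable
      (M := Real.pi⁻¹ * ∫ r in Ioi (0 : ℝ), ‖G (Real.log r + θ * Complex.I)‖) ?_
    exact (ae_restrict_iff' measurableSet_Ioc).2
      (Eventually.of_forall fun s hs => abs_rayDensity_le_const hcos hint hs.1.le)
  · refine Integrable.mono' ((integrableOn_Ioi_rpow_of_lt (a := -(b + 1)) (by linarith)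
      one_pos).const_mul (Real.pi⁻¹ * (K * ((-Real.cos θ) ^ (-(b + 1)) * Real.Gamma (b + 1)))))
      (measurable_rayDensity hG θ).aestronglyMeasurable ?_
    exact (ae_restrict_iff' measurableSet_Ioi).2 (Eventually.of_forall fun s hs =>
      abs_rayDensity_le_rpow hcos hG hb hK (one_pos.trans hs))

/-- The density `rayDensity G θ` has Laplace transform `G ∘ log`. -/
theorem laplace_rayDensity {G : ℂ → ℂ} {θ D : ℝ} (h0 : 0 < θ) (hπ : θ < Real.pi)
    (hcos : Real.cos θ < 0) (hG : Differentiable ℂ G) (hreal : ∀ u : ℝ, (G u).im = 0)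
    (hD : ∀ w : ℂ, w.im ∈ Icc 0 θ → ‖G w‖ * (1 + Real.exp w.re) ^ 2 ≤ D) {l : ℝ} (hl : 0 < l) :
    ∫ s in Ioi (0 : ℝ), rayDensity G θ s * Real.exp (-(s * l)) = (G (Real.log l)).re := by
  set e := Complex.exp (θ * Complex.I) with he
  have hGint := integrableOn_comp_log_ray h0.le hG.continuous hD
  set Φ : ℝ → ℝ → ℂ := fun s r => Complex.exp (-(s * l)) * (Complex.exp (s * e * r) *
    (G (Real.log r + θ * Complex.I) * e)) with hΦ
  have hexpint : IntegrableOn (fun s : ℝ => Real.exp (-l * s)) (Ioi 0) :=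
    integrableOn_exp_mul_Ioi (by linarith) 0
  have hprod : Integrable (Function.uncurry Φ)
      ((volume.restrict (Ioi (0 : ℝ))).prod (volume.restrict (Ioi (0 : ℝ)))) := by
    refine Integrable.mono' (hexpint.mul_prod hGint.norm) ?_ ?_
    · refine Measurable.aestronglyMeasurable ?_
      exact Measurable.mul (by fun_prop) (measurable_rayIntegrand hG.continuous θ)
    · rw [Measure.prod_restrict]
      refine (ae_restrict_iff' (measurableSet_Ioi.prod measurableSet_Ioi)).2
        (Eventually.of_forall fun q hq => ?_)
      obtain ⟨hs, hr⟩ := hq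
      have hs' : (0 : ℝ) < q.1 := hs
      have hr' : (0 : ℝ) < q.2 := hr
      simp only [Function.uncurry, hΦ]
      rw [norm_mul, norm_mul, he, norm_exp_ray, norm_mul, Complex.norm_exp_ofReal_mul_I, mul_one]
      have h1 : ‖Complex.exp (-(q.1 * l))‖ = Real.exp (-l * q.1) := by
        rw [Complex.norm_exp]; congr 1; simp [mul_comm]
      rw [h1]
      gcongr
      refine mul_le_of_le_one_left (norm_nonneg _) (Real.exp_le_one_iff.2 ?_)
      nlinarith [mul_pos hs' hr']
  have hswap := integral_integral_swap hprod
  have hleft : (∫ s in Ioi (0 : ℝ), ∫ r in Ioi (0 : ℝ), Φ s r).im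
      = Real.pi * ∫ s in Ioi (0 : ℝ), rayDensity G θ s * Real.exp (-(s * l)) := by
    have := integral_im (𝕜 := ℂ) hprod.integral_prod_left
    simp only [RCLike.im_to_complex] at this
    rw [← integral_const_mul]
    refine this.symm.trans (integral_congr_ae (Eventually.of_forall fun s => ?_))
    simp only [Function.uncurry, hΦ, integral_const_mul, rayDensity]
    rw [show Complex.exp (-(s * l)) = ((Real.exp (-(s * l)) : ℝ) : ℂ) by push_cast; rfl,
      Complex.im_ofReal_mul, ← he]
    field_simp [Real.pi_ne_zero]
  -- Integrating in `s` first turns the exponential into the Cauchy kernel; convergence uses `cos θ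
  -- < 0` and `l > 0`.
  have hright : (∫ r in Ioi (0 : ℝ), ∫ s in Ioi (0 : ℝ), Φ s r)
      = -∫ r in Ioi (0 : ℝ), e * (G (Real.log r + θ * Complex.I) / (r * e - l)) := by
    rw [← integral_neg]
    refine setIntegral_congr_fun measurableSet_Ioi fun r hr => ?_
    have hr' : (0 : ℝ) < r := hr
    have hre : ((r : ℂ) * e - l).re < 0 := by
      simp [he, Complex.exp_ofReal_mul_I_re]
      nlinarith
    have : ∀ s : ℝ, Φ s r = Complex.exp ((r * e - l) * s) *
        (G (Real.log r + θ * Complex.I) * e) := by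
      intro s
      simp only [hΦ]
      rw [← mul_assoc, ← Complex.exp_add]
      ring_nf
    simp_rw [this]
    rw [integral_mul_const, integral_exp_mul_complex_Ioi hre]
    simp
    ring
  have hC := im_integral_ray_cauchy h0 hπ hG hreal hD (Real.log l)
  rw [Real.exp_log hl, ← he] at hC
  rw [hright] at hswap
  rw [hswap, Complex.neg_im, hC, neg_neg] at hleft
  exact (mul_left_cancel₀ Real.pi_ne_zero hleft).symm

end Laplace

/-! ### Subordination densities for the stable symbols. -/

section Stable

open MeasureTheory Set Filter Topology

/-- The symbol `z ^ q * exp (-t * z ^ a)` in the logarithmic variable `w = log z`. -/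
noncomputable def stableLog (a q t : ℝ) (w : ℂ) : ℂ :=
  Complex.exp (q * w - t * Complex.exp (a * w))

theorem differentiable_stableLog (a q t : ℝ) : Differentiable ℂ (stableLog a q t) := by
  unfold stableLog
  fun_prop

theorem stableLog_ofReal (a q t u : ℝ) :
    stableLog a q t u = (Real.exp (q * u - t * Real.exp (a * u)) : ℝ) := by
  simp [stableLog]

theorem stableLog_log (a q t : ℝ) {l : ℝ} (hl : 0 < l) :
    (stableLog a q t (Real.log l)).re = l ^ q * Real.exp (-(t * l ^ a)) := by
  rw [stableLog_ofReal, Complex.ofReal_re, sub_eq_add_neg, Real.exp_add, Real.rpow_def_of_pos hl,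
    Real.rpow_def_of_pos hl, mul_comm q, mul_comm a]

theorem norm_stableLog (a q t : ℝ) (w : ℂ) : ‖stableLog a q t w‖ =
    Real.exp (q * w.re - t * (Real.exp (a * w.re) * Real.cos (a * w.im))) := by
  rw [stableLog, Complex.norm_exp]
  congr 1
  simp [Complex.exp_re]

theorem exists_exp_sub_exp_le {q a c : ℝ} (hq : 0 ≤ q) (ha : 0 < a) (hc : 0 < c) :
    ∃ D, 0 ≤ D ∧ ∀ u : ℝ, Real.exp (q * u - c * Real.exp (a * u)) ≤ D := by
  rcases hq.eq_or_lt with rfl | hq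
  · refine ⟨1, zero_le_one, fun u => Real.exp_le_one_iff.2 ?_⟩
    have := Real.exp_pos (a * u)
    nlinarith
  -- This is the maximum over `u`, attained where `exp (a * u) = q / (a * c)`; the tangent-line
  -- inequality for `exp` at that point proves the bound.
  · refine ⟨Real.exp (q / a * (-1 - Real.log (a * c / q))), (Real.exp_pos _).le,
      fun u => Real.exp_le_exp.2 ?_⟩
    have h := Real.add_one_le_exp (a * u + Real.log (a * c / q))
    rw [Real.exp_add, Real.exp_log (by positivity)] at h
    have h2 : q * u - c * Real.exp (a * u)
        = q / a * (a * u - Real.exp (a * u) * (a * c / q)) := by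
      field_simp
    rw [h2]
    exact mul_le_mul_of_nonneg_left (by linarith) (by positivity)

/-- Throughout the strip `cos (a * w.im) ≥ cos (a * θ) > 0`, so the symbol decays superpolynomially
in `exp w.re`. Since `(1 + ρ)² ≤ 2 + 2ρ²`, it suffices to bound the exponents `q` and `q + 2`. -/
theorem exists_stableLog_decay {a q t θ : ℝ} (ha : 0 < a) (hq : 0 ≤ q) (ht : 0 < t)
    (hθ : a * θ < Real.pi / 2) :
    ∃ D, ∀ w : ℂ, w.im ∈ Icc 0 θ → ‖stableLog a q t w‖ * (1 + Real.exp w.re) ^ 2 ≤ D := by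
  rcases lt_or_ge θ 0 with h0 | h0
  · exact ⟨0, fun w hw => absurd (hw.1.trans hw.2) (not_le.2 h0)⟩
  have hc : 0 < Real.cos (a * θ) :=
    Real.cos_pos_of_mem_Ioo ⟨by have := Real.pi_pos; nlinarith [mul_nonneg ha.le h0], hθ⟩
  obtain ⟨D₁, -, h1⟩ := exists_exp_sub_exp_le hq ha (mul_pos ht hc)
  obtain ⟨D₂, -, h2⟩ := exists_exp_sub_exp_le (q := q + 2) (by linarith) ha (mul_pos ht hc)
  refine ⟨2 * D₁ + 2 * D₂, fun w hw => ?_⟩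
  have hcos : Real.cos (a * θ) ≤ Real.cos (a * w.im) :=
    Real.cos_le_cos_of_nonneg_of_le_pi (mul_nonneg ha.le hw.1) (by linarith [Real.pi_pos])
      (mul_le_mul_of_nonneg_left hw.2 ha.le)
  have hn : ‖stableLog a q t w‖
      ≤ Real.exp (q * w.re - t * Real.cos (a * θ) * Real.exp (a * w.re)) := by
    rw [norm_stableLog]
    refine Real.exp_le_exp.2 (sub_le_sub_left ?_ _)
    calc _ = t * (Real.exp (a * w.re) * Real.cos (a * θ)) := by ring
      _ ≤ _ := by gcongr
  have h3 : Real.exp ((q + 2) * w.re - t * Real.cos (a * θ) * Real.exp (a * w.re))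
      = Real.exp (q * w.re - t * Real.cos (a * θ) * Real.exp (a * w.re)) * Real.exp w.re ^ 2 := by
    rw [← Real.exp_nat_mul, ← Real.exp_add]
    congr 1
    push_cast
    ring
  have h4 : (1 + Real.exp w.re) ^ 2 ≤ 2 + 2 * Real.exp w.re ^ 2 := by
    nlinarith [sq_nonneg (1 - Real.exp w.re)]
  have h1' := h1 w.re
  have h2' := h2 w.re
  rw [h3] at h2'
  calc _ ≤ Real.exp (q * w.re - t * Real.cos (a * θ) * Real.exp (a * w.re)) *
        (2 + 2 * Real.exp w.re ^ 2) := by gcongr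
    _ ≤ _ := by linarith

/-- Mean value inequality on the right half-plane, which is convex and where the derivative has norm
at most one. -/
theorem norm_exp_neg_sub_one_le {w : ℂ} (hw : 0 ≤ w.re) : ‖Complex.exp (-w) - 1‖ ≤ ‖w‖ := by
  have hconv : Convex ℝ {z : ℂ | 0 ≤ z.re} := convex_halfSpace_re_ge 0
  have := hconv.norm_image_sub_le_of_norm_hasDerivWithin_le (f := fun z => Complex.exp (-z))
    (f' := fun z => Complex.exp (-z) * -1) (C := 1) (x := 0) (y := w)
    (fun z _ => ((hasDerivAt_neg z).cexp).hasDerivWithinAt) (fun z hz => ?_) (by simp) hw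
  · simpa using this
  · have hz' : 0 ≤ z.re := hz
    rw [norm_mul, Complex.norm_exp]
    simpa using hz'

/-- The choice `θ = π / (1 + a)` meets both angular conditions exactly because `a < 1`, which is
where `σ < 2` is needed. -/
theorem exists_sector_angle {a : ℝ} (ha0 : 0 < a) (ha1 : a < 1) :
    ∃ θ : ℝ, 0 < θ ∧ θ < Real.pi ∧ Real.cos θ < 0 ∧ a * θ < Real.pi / 2 := by
  have hπ := Real.pi_pos
  have h1 : Real.pi / (1 + a) < Real.pi := div_lt_self hπ (by linarith)
  refine ⟨Real.pi / (1 + a), by positivity, h1, ?_, ?_⟩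
  · refine Real.cos_neg_of_pi_div_two_lt_of_lt ?_ (by linarith)
    exact div_lt_div_of_pos_left hπ (by linarith) (by linarith)
  · rw [mul_div_assoc', div_lt_div_iff₀ (by linarith) two_pos]
    nlinarith

/-- The absence of `t` on the right is the source of the uniformity in time of `exists_density`. -/
theorem stableLog_ray (a q t θ : ℝ) {r : ℝ} (hr : 0 < r) (hcos : 0 ≤ Real.cos (a * θ))
    (ht : 0 ≤ t) : ‖stableLog a q t (Real.log r + θ * Complex.I)‖ ≤ r ^ q := by
  rw [norm_stableLog, Real.rpow_def_of_pos hr, mul_comm (Real.log r)]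
  refine Real.exp_le_exp.2 ?_
  simp only [Complex.add_re, Complex.ofReal_re, Complex.mul_re, Complex.I_re, mul_zero,
    Complex.ofReal_im, Complex.I_im, mul_one, sub_self, add_zero, Complex.add_im, Complex.mul_im,
    zero_add]
  have : 0 ≤ t * (Real.exp (a * Real.log r) * Real.cos (a * θ)) := by positivity
  linarith

/-- Gaussian subordination of `l ^ q * exp (-t * l ^ a)` for `q > 0`, with a density bounded
uniformly in `t`. -/
theorem exists_density {a q : ℝ} (ha0 : 0 < a) (ha1 : a < 1) (hq : 0 < q) :
    ∃ C : ℝ, 0 ≤ C ∧ ∀ t : ℝ, 0 < t → ∃ η : ℝ → ℝ, IntegrableOn η (Ioi 0) ∧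
      (∀ s : ℝ, 0 < s → |η s| ≤ C * s ^ (-(q + 1))) ∧
      ∀ l : ℝ, 0 < l →
        ∫ s in Ioi (0 : ℝ), η s * Real.exp (-(s * l)) = l ^ q * Real.exp (-(t * l ^ a)) := by
  obtain ⟨θ, h0, hπ, hcos, haθ⟩ := exists_sector_angle ha0 ha1
  have hc : 0 ≤ Real.cos (a * θ) := (Real.cos_pos_of_mem_Ioo
    ⟨by have := Real.pi_pos; nlinarith [mul_pos ha0 h0], haθ⟩).le
  have hΓ := (Real.Gamma_pos_of_pos (show 0 < q + 1 by linarith)).le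
  have hcp := (Real.rpow_pos_of_pos (show 0 < -Real.cos θ by linarith) (-(q + 1))).le
  refine ⟨Real.pi⁻¹ * (1 * ((-Real.cos θ) ^ (-(q + 1)) * Real.Gamma (q + 1))),
    by have := Real.pi_pos; positivity, fun t ht => ?_⟩
  obtain ⟨D, hD⟩ := exists_stableLog_decay ha0 hq.le ht haθ
  have hd := differentiable_stableLog a q t
  have hK : ∀ r : ℝ, 0 < r →
      ‖stableLog a q t (Real.log r + θ * Complex.I) - (0 : ℝ)‖ ≤ 1 * r ^ q := fun r hr => by
    simpa using stableLog_ray a q t θ hr hc ht.le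
  refine ⟨rayDensity (stableLog a q t) θ,
    integrableOn_rayDensity hcos hd.continuous (integrableOn_comp_log_ray h0.le hd.continuous hD)
      hq hK, fun s hs => abs_rayDensity_le_rpow hcos hd.continuous hq hK hs, fun l hl => ?_⟩
  rw [laplace_rayDensity h0 hπ hcos hd (fun u => by rw [stableLog_ofReal, Complex.ofReal_im]) hD hl,
    stableLog_log a q t hl]

/-- Gaussian subordination of `exp (-t * l ^ a)`. -/
theorem exists_density_zero {a : ℝ} (ha0 : 0 < a) (ha1 : a < 1) {t : ℝ} (ht : 0 < t) :
    ∃ C : ℝ, 0 ≤ C ∧ ∃ η : ℝ → ℝ, IntegrableOn η (Ioi 0) ∧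
      (∀ s : ℝ, 0 < s → |η s| ≤ C * s ^ (-(a + 1))) ∧
      ∀ l : ℝ, 0 < l →
        ∫ s in Ioi (0 : ℝ), η s * Real.exp (-(s * l)) = Real.exp (-(t * l ^ a)) := by
  obtain ⟨θ, h0, hπ, hcos, haθ⟩ := exists_sector_angle ha0 ha1
  have hc : 0 ≤ Real.cos (a * θ) := (Real.cos_pos_of_mem_Ioo
    ⟨by have := Real.pi_pos; nlinarith [mul_pos ha0 h0], haθ⟩).le
  have hΓ := (Real.Gamma_pos_of_pos (show 0 < a + 1 by linarith)).le
  have hcp := (Real.rpow_pos_of_pos (show 0 < -Real.cos θ by linarith) (-(a + 1))).le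
  refine ⟨Real.pi⁻¹ * (t * ((-Real.cos θ) ^ (-(a + 1)) * Real.Gamma (a + 1))),
    by have := Real.pi_pos; positivity, ?_⟩
  obtain ⟨D, hD⟩ := exists_stableLog_decay ha0 le_rfl ht haθ
  have hd := differentiable_stableLog a 0 t
  -- For `q = 0` the symbol tends to one at the origin, so one is subtracted. The remainder is at
  -- most `t * r ^ a`, and the constant now depends on `t`.
  have hK : ∀ r : ℝ, 0 < r →
      ‖stableLog a 0 t (Real.log r + θ * Complex.I) - (1 : ℝ)‖ ≤ t * r ^ a := fun r hr => by
    have hrr : r ^ a = Real.exp (a * Real.log r) := by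
      rw [Real.rpow_def_of_pos hr, mul_comm]
    have hre : 0 ≤ (t * Complex.exp (a * (Real.log r + θ * Complex.I)) : ℂ).re := by
      simp only [Complex.re_ofReal_mul, Complex.exp_re]
      simp
      positivity
    have := norm_exp_neg_sub_one_le hre
    have hn : ‖(t * Complex.exp (a * (Real.log r + θ * Complex.I)) : ℂ)‖ = t * r ^ a := by
      rw [norm_mul, Complex.norm_exp, Complex.norm_real, Real.norm_of_nonneg ht.le, hrr]
      simp
    rw [hn] at this
    simpa [stableLog] using this
  refine ⟨rayDensity (stableLog a 0 t) θ,
    integrableOn_rayDensity hcos hd.continuous (integrableOn_comp_log_ray h0.le hd.continuous hD)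
      ha0 hK, fun s hs => abs_rayDensity_le_rpow hcos hd.continuous ha0 hK hs, fun l hl => ?_⟩
  rw [laplace_rayDensity h0 hπ hcos hd (fun u => by rw [stableLog_ofReal, Complex.ofReal_im]) hD hl,
    stableLog_log a 0 t hl, Real.rpow_zero, one_mul]

end Stable

/-! ### From Laplace transforms to superpositions of Gauss kernels. -/

section Subordination

open MeasureTheory Set Filter Topology

/-- The inversion `s ↦ 1/s` turns this into the Gamma integral. -/
theorem integral_rpow_mul_exp_neg_div {κ ρ : ℝ} (hκ : 0 < κ) (hρ : 0 < ρ) :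
    IntegrableOn (fun s : ℝ => s ^ (-(κ + 1)) * Real.exp (-(ρ / s))) (Ioi 0) ∧
    ∫ s in Ioi (0 : ℝ), s ^ (-(κ + 1)) * Real.exp (-(ρ / s)) = Real.Gamma κ * ρ ^ (-κ) := by
  have hcongr : ∀ s ∈ Ioi (0 : ℝ), (|(-1 : ℝ)| * s ^ ((-1 : ℝ) - 1)) •
      ((s ^ (-1 : ℝ)) ^ (κ - 1) * Real.exp (-(ρ * s ^ (-1 : ℝ))))
        = s ^ (-(κ + 1)) * Real.exp (-(ρ / s)) := by
    intro s hs
    have hs' : (0 : ℝ) < s := hs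
    rw [abs_neg, abs_one, one_mul, smul_eq_mul, ← mul_assoc, ← Real.rpow_mul hs'.le,
      ← Real.rpow_add hs', Real.rpow_neg_one, div_eq_mul_inv]
    congr 2
    ring
  constructor
  · refine IntegrableOn.congr_fun ?_ hcongr measurableSet_Ioi
    refine (integrableOn_Ioi_comp_rpow_iff (fun y : ℝ => y ^ (κ - 1) * Real.exp (-(ρ * y)))
      (by norm_num : (-1 : ℝ) ≠ 0)).2 ?_
    have := integrableOn_rpow_mul_exp_neg_mul_rpow (s := κ - 1) (p := 1) (by linarith) one_pos hρ
    simpa using this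
  · rw [← setIntegral_congr_fun measurableSet_Ioi hcongr,
      integral_comp_rpow_Ioi (fun y : ℝ => y ^ (κ - 1) * Real.exp (-(ρ * y)))
      (by norm_num : (-1 : ℝ) ≠ 0), Real.integral_rpow_mul_exp_neg_mul_Ioi hκ hρ, one_div,
      Real.inv_rpow hρ.le, Real.rpow_neg hρ.le, mul_comm]

/-- The Gauss kernel at time `s`. -/
noncomputable def gaussKernel (N : ℕ) (s : ℝ) (x : EuclideanSpace ℝ (Fin N)) : ℝ :=
  (4 * Real.pi * s) ^ (-((N : ℝ) / 2)) * Real.exp (-(‖x‖ ^ 2 / 4 / s))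

theorem fourierInv_gauss (N : ℕ) {s : ℝ} (hs : 0 < s) (x : EuclideanSpace ℝ (Fin N)) :
    𝓕⁻ (fun ξ : EuclideanSpace ℝ (Fin N) =>
      ((Real.exp (-(s * (2 * Real.pi * ‖ξ‖) ^ 2)) : ℝ) : ℂ)) x = gaussKernel N s x := by
  have hπ := Real.pi_pos
  have hb : 0 < ((4 * Real.pi ^ 2 * s : ℝ) : ℂ).re := by
    rw [Complex.ofReal_re]; positivity
  have h := fourier_gaussian_innerProductSpace hb (-x)
  rw [Real.fourierInv_eq_fourier_neg]
  have hfun : (fun ξ : EuclideanSpace ℝ (Fin N) =>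
      ((Real.exp (-(s * (2 * Real.pi * ‖ξ‖) ^ 2)) : ℝ) : ℂ))
      = fun ξ => Complex.exp (-((4 * Real.pi ^ 2 * s : ℝ) : ℂ) * ‖ξ‖ ^ 2) := by
    ext ξ
    push_cast
    congr 1
    ring
  rw [hfun, h, gaussKernel]
  have h1 : (Real.pi / ((4 * Real.pi ^ 2 * s : ℝ) : ℂ)) = (((4 * Real.pi * s)⁻¹ : ℝ) : ℂ) := by
    have : (Real.pi : ℂ) ≠ 0 := by exact_mod_cast hπ.ne'
    have : (s : ℂ) ≠ 0 := by exact_mod_cast hs.ne'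
    push_cast
    field_simp
  have h2 : ((Module.finrank ℝ (EuclideanSpace ℝ (Fin N)) : ℂ) / 2)
      = (((N : ℝ) / 2 : ℝ) : ℂ) := by simp
  rw [h1, h2, ← Complex.ofReal_cpow (by positivity), Real.inv_rpow (by positivity),
    ← Real.rpow_neg (by positivity)]
  push_cast
  congr 2
  have : (Real.pi : ℂ) ≠ 0 := by exact_mod_cast hπ.ne'
  have : (s : ℂ) ≠ 0 := by exact_mod_cast hs.ne'
  rw [norm_neg]
  field_simp

theorem integrable_exp_neg_mul_two_pi_norm_sq (N : ℕ) {s : ℝ} (hs : 0 < s) :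
    Integrable (fun ξ : EuclideanSpace ℝ (Fin N) =>
      Real.exp (-(s * (2 * Real.pi * ‖ξ‖) ^ 2))) := by
  have hπ := Real.pi_pos
  have hb : 0 < ((4 * Real.pi ^ 2 * s : ℝ) : ℂ).re := by
    rw [Complex.ofReal_re]; positivity
  have h := (GaussianFourier.integrable_cexp_neg_mul_sq_norm_add hb 0
    (0 : EuclideanSpace ℝ (Fin N))).norm
  refine h.congr (Eventually.of_forall fun ξ => ?_)
  simp only [Complex.norm_exp]
  congr 1
  rw [zero_mul, add_zero, ← Complex.ofReal_pow, ← Complex.ofReal_neg, ← Complex.ofReal_mul,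
    Complex.ofReal_re]
  ring

theorem gaussKernel_nonneg (N : ℕ) {s : ℝ} (hs : 0 < s) (x : EuclideanSpace ℝ (Fin N)) :
    0 ≤ gaussKernel N s x := by
  have := Real.pi_pos
  unfold gaussKernel
  positivity

theorem gaussKernel_eq (N : ℕ) {s : ℝ} (hs : 0 < s) (x : EuclideanSpace ℝ (Fin N)) :
    gaussKernel N s x = (4 * Real.pi) ^ (-((N : ℝ) / 2)) *
      (s ^ (-((N : ℝ) / 2)) * Real.exp (-(‖x‖ ^ 2 / 4 / s))) := by
  have := Real.pi_pos
  rw [gaussKernel, Real.mul_rpow (by positivity) hs.le, mul_assoc]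

/-- With `s = exp (-u)` this is the bound of `exists_exp_sub_exp_le`. It supplies the dominating
constant when the regularization is removed. -/
theorem exists_gaussKernel_le (N : ℕ) {x : EuclideanSpace ℝ (Fin N)} (hx : x ≠ 0) :
    ∃ B, ∀ s : ℝ, 0 < s → gaussKernel N s x ≤ B := by
  have hπ := Real.pi_pos
  have hx' : 0 < ‖x‖ := norm_pos_iff.2 hx
  obtain ⟨D, -, hD⟩ := exists_exp_sub_exp_le (q := (N : ℝ) / 2) (a := 1) (c := ‖x‖ ^ 2 / 4)
    (by positivity) one_pos (by positivity)
  refine ⟨(4 * Real.pi) ^ (-((N : ℝ) / 2)) * D, fun s hs => ?_⟩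
  rw [gaussKernel_eq N hs]
  refine mul_le_mul_of_nonneg_left ((le_of_eq ?_).trans (hD (-Real.log s))) (by positivity)
  rw [one_mul, Real.exp_neg (Real.log s), Real.exp_log hs, sub_eq_add_neg, Real.exp_add,
    Real.rpow_def_of_pos hs, div_eq_mul_inv _ s]
  congr 2
  ring

/-- Subordination: a multiplier that is a Laplace transform in `|2πξ|²` has as kernel the
corresponding superposition of Gauss kernels, away from the origin. -/
theorem fourierInv_eq_integral_gaussKernel {N : ℕ}
    {m : EuclideanSpace ℝ (Fin N) → ℂ} (hm : Integrable m) {η : ℝ → ℝ}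
    (hη : IntegrableOn η (Ioi 0))
    (hmη : ∀ ξ, ξ ≠ 0 →
      m ξ = ((∫ s in Ioi (0 : ℝ), η s * Real.exp (-(s * (2 * Real.pi * ‖ξ‖) ^ 2)) : ℝ) : ℂ))
    {x : EuclideanSpace ℝ (Fin N)} (hx : x ≠ 0) :
    IntegrableOn (fun s => η s * gaussKernel N s x) (Ioi 0) ∧
    𝓕⁻ m x = ((∫ s in Ioi (0 : ℝ), η s * gaussKernel N s x : ℝ) : ℂ) := by
  have hπ := Real.pi_pos
  obtain ⟨B, hB⟩ := exists_gaussKernel_le N hx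
  have hgmeas : ∀ ε : ℝ, Measurable (fun s : ℝ => gaussKernel N (s + ε) x) := by
    intro ε; unfold gaussKernel; fun_prop
  have hbd : ∀ ε : ℝ, 0 ≤ ε → ∀ᵐ s ∂(volume.restrict (Ioi (0 : ℝ))),
      ‖η s * gaussKernel N (s + ε) x‖ ≤ |η s| * B := by
    intro ε hε
    refine (ae_restrict_iff' measurableSet_Ioi).2 (Eventually.of_forall fun s hs => ?_)
    have hs' : 0 < s + ε := add_pos_of_pos_of_nonneg hs hε
    rw [norm_mul, Real.norm_of_nonneg (gaussKernel_nonneg N hs' x), Real.norm_eq_abs]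
    exact mul_le_mul_of_nonneg_left (hB _ hs') (abs_nonneg _)
  have hint : IntegrableOn (fun s => η s * gaussKernel N s x) (Ioi 0) := by
    have := hbd 0 le_rfl
    simp only [add_zero] at this
    refine Integrable.mono' (hη.abs.mul_const B) ?_ this
    have := hgmeas 0
    simp only [add_zero] at this
    exact hη.aestronglyMeasurable.mul this.aestronglyMeasurable
  refine ⟨hint, ?_⟩
  have : Nontrivial (EuclideanSpace ℝ (Fin N)) := ⟨x, 0, hx⟩
  have hne : ∀ᵐ ξ : EuclideanSpace ℝ (Fin N), ξ ≠ 0 := by simp [ae_iff]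
  -- the regularized identity
  have hreg : ∀ ε : ℝ, 0 < ε →
      ∫ ξ : EuclideanSpace ℝ (Fin N), Complex.exp (↑(2 * Real.pi * inner ℝ ξ x) * Complex.I) •
        (m ξ * (Real.exp (-(ε * (2 * Real.pi * ‖ξ‖) ^ 2)) : ℝ))
      = ((∫ s in Ioi (0 : ℝ), η s * gaussKernel N (s + ε) x : ℝ) : ℂ) := by
    intro ε hε
    set Φ : EuclideanSpace ℝ (Fin N) → ℝ → ℂ := fun ξ s =>
      Complex.exp (↑(2 * Real.pi * inner ℝ ξ x) * Complex.I) *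
        (((Real.exp (-((s + ε) * (2 * Real.pi * ‖ξ‖) ^ 2)) : ℝ) : ℂ) * η s) with hΦ
    -- The Gaussian factor in `ε` makes Fubini legitimate: without it, the integral in `ξ` of
    -- `exp(-s|2πξ|²)` grows like `s^{-N/2}` as `s → 0`, which integrability of `η` alone does not
    -- absorb.
    have hprod : Integrable (Function.uncurry Φ)
        ((volume : Measure (EuclideanSpace ℝ (Fin N))).prod (volume.restrict (Ioi (0 : ℝ)))) := by
      refine Integrable.mono' ((integrable_exp_neg_mul_two_pi_norm_sq N hε).mul_prod hη.abs) ?_ ?_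
      · have h1 : AEStronglyMeasurable (fun q : EuclideanSpace ℝ (Fin N) × ℝ => η q.2)
            (volume.prod (volume.restrict (Ioi (0 : ℝ)))) := hη.aestronglyMeasurable.comp_snd
        refine AEStronglyMeasurable.mul (Measurable.aestronglyMeasurable (by fun_prop)) ?_
        refine AEStronglyMeasurable.mul (Measurable.aestronglyMeasurable (by fun_prop)) ?_
        exact Complex.continuous_ofReal.comp_aestronglyMeasurable h1
      · have hae : ∀ᵐ q ∂((volume : Measure (EuclideanSpace ℝ (Fin N))).prod
            (volume.restrict (Ioi (0 : ℝ)))), 0 < q.2 := by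
          have := (Measure.quasiMeasurePreserving_snd
            (μ := (volume : Measure (EuclideanSpace ℝ (Fin N))))
            (ν := volume.restrict (Ioi (0 : ℝ)))).ae (ae_restrict_mem measurableSet_Ioi)
          exact this
        filter_upwards [hae] with q hq
        simp only [Function.uncurry, hΦ]
        rw [norm_mul, Complex.norm_exp_ofReal_mul_I, one_mul, norm_mul, Complex.norm_real,
          Complex.norm_real, Real.norm_of_nonneg (Real.exp_pos _).le, Real.norm_eq_abs]
        refine mul_le_mul_of_nonneg_right (Real.exp_le_exp.2 ?_) (abs_nonneg _)
        have : 0 ≤ (2 * Real.pi * ‖q.1‖) ^ 2 := by positivity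
        nlinarith
    have hswap := integral_integral_swap hprod
    have hl : ∫ ξ : EuclideanSpace ℝ (Fin N),
        Complex.exp (↑(2 * Real.pi * inner ℝ ξ x) * Complex.I) •
          (m ξ * (Real.exp (-(ε * (2 * Real.pi * ‖ξ‖) ^ 2)) : ℝ))
        = ∫ ξ : EuclideanSpace ℝ (Fin N), ∫ s in Ioi (0 : ℝ), Φ ξ s := by
      refine integral_congr_ae ?_
      filter_upwards [hne] with ξ hξ
      simp only [hΦ, integral_const_mul, smul_eq_mul]
      rw [hmη ξ hξ, ← integral_complex_ofReal, ← integral_mul_const]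
      congr 1
      refine integral_congr_ae (Eventually.of_forall fun s => ?_)
      simp only
      rw [add_mul, neg_add, Real.exp_add]
      push_cast
      ring
    rw [hl, hswap, ← integral_complex_ofReal]
    refine setIntegral_congr_fun measurableSet_Ioi fun s hs => ?_
    have hs' : 0 < s + ε := add_pos hs hε
    have := fourierInv_gauss N hs' x
    rw [Real.fourierInv_eq'] at this
    simp only [hΦ]
    rw [Complex.ofReal_mul, ← this, mul_comm (η s : ℂ), ← integral_mul_const]
    simp only [smul_eq_mul, mul_assoc]
  have hL : Tendsto (fun ε : ℝ => ∫ ξ : EuclideanSpace ℝ (Fin N),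
      Complex.exp (↑(2 * Real.pi * inner ℝ ξ x) * Complex.I) •
        (m ξ * (Real.exp (-(ε * (2 * Real.pi * ‖ξ‖) ^ 2)) : ℝ))) (𝓝[>] 0) (𝓝 (𝓕⁻ m x)) := by
    rw [Real.fourierInv_eq']
    refine tendsto_integral_filter_of_dominated_convergence (fun ξ => ‖m ξ‖) ?_ ?_ hm.norm ?_
    · refine Eventually.of_forall fun ε => ?_
      simp only [smul_eq_mul]
      refine AEStronglyMeasurable.mul ?_ (AEStronglyMeasurable.mul hm.aestronglyMeasurable ?_)
      · exact Measurable.aestronglyMeasurable (by fun_prop)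
      · exact Measurable.aestronglyMeasurable (by fun_prop)
    · filter_upwards [self_mem_nhdsWithin] with ε hε
      refine Eventually.of_forall fun ξ => ?_
      have hε' : (0 : ℝ) < ε := hε
      rw [norm_smul, Complex.norm_exp_ofReal_mul_I, one_mul, norm_mul, Complex.norm_real,
        Real.norm_of_nonneg (Real.exp_pos _).le]
      refine mul_le_of_le_one_right (norm_nonneg _) (Real.exp_le_one_iff.2 ?_)
      have : 0 ≤ ε * (2 * Real.pi * ‖ξ‖) ^ 2 := by positivity
      linarith
    · refine Eventually.of_forall fun ξ => ?_
      have hc : Continuous (fun ε : ℝ =>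
          Complex.exp (↑(2 * Real.pi * inner ℝ ξ x) * Complex.I) •
            (m ξ * (Real.exp (-(ε * (2 * Real.pi * ‖ξ‖) ^ 2)) : ℝ))) := by fun_prop
      have := (hc.tendsto 0).mono_left (nhdsWithin_le_nhds (s := Ioi (0 : ℝ)))
      simpa using this
  have hR : Tendsto (fun ε : ℝ => ∫ s in Ioi (0 : ℝ), η s * gaussKernel N (s + ε) x) (𝓝[>] 0)
      (𝓝 (∫ s in Ioi (0 : ℝ), η s * gaussKernel N s x)) := by
    refine tendsto_integral_filter_of_dominated_convergence (fun s => |η s| * B) ?_ ?_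
      (hη.abs.mul_const B) ?_
    · exact Eventually.of_forall fun ε =>
        hη.aestronglyMeasurable.mul (hgmeas ε).aestronglyMeasurable
    · filter_upwards [self_mem_nhdsWithin] with ε hε
      exact hbd ε (le_of_lt hε)
    · refine (ae_restrict_iff' measurableSet_Ioi).2 (Eventually.of_forall fun s hs => ?_)
      have hs' : (0 : ℝ) < s := hs
      refine Tendsto.const_mul _ (Tendsto.mono_left ?_ nhdsWithin_le_nhds)
      have hc : ContinuousAt (fun ε : ℝ => gaussKernel N (s + ε) x) 0 := by
        unfold gaussKernel
        have h1 : 4 * Real.pi * (s + 0) ≠ 0 := by rw [add_zero]; positivity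
        have h2 : s + 0 ≠ 0 := by rw [add_zero]; exact hs'.ne'
        refine ContinuousAt.mul (ContinuousAt.rpow_const (by fun_prop) (Or.inl h1)) ?_
        fun_prop (disch := assumption)
      simpa [ContinuousAt] using hc
  have hR' := (Complex.continuous_ofReal.tendsto _).comp hR
  refine tendsto_nhds_unique hL (hR'.congr' ?_)
  filter_upwards [self_mem_nhdsWithin] with ε hε
  exact (hreg ε hε).symm

end Subordination

/-! ### Spatial decay of subordinated kernels. -/

section KernelBounds

open MeasureTheory Set Filter Topology

/-- The density bound times the Gauss kernel is `s^{-(κ+1)} exp(-|x|²/(4s))` up to a constant, with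
`κ = N/2 + q`. Its integral scales as `|x|^{-2κ}`. -/
theorem norm_fourierInv_le_rpow {N : ℕ} {m : EuclideanSpace ℝ (Fin N) → ℂ} (hm : Integrable m)
    {η : ℝ → ℝ} (hη : IntegrableOn η (Ioi 0))
    (hmη : ∀ ξ, ξ ≠ 0 →
      m ξ = ((∫ s in Ioi (0 : ℝ), η s * Real.exp (-(s * (2 * Real.pi * ‖ξ‖) ^ 2)) : ℝ) : ℂ))
    {C q : ℝ} (hq : 0 < q) (hC : ∀ s : ℝ, 0 < s → |η s| ≤ C * s ^ (-(q + 1)))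
    {x : EuclideanSpace ℝ (Fin N)} (hx : x ≠ 0) :
    ‖𝓕⁻ m x‖ ≤ (4 * Real.pi) ^ (-((N : ℝ) / 2)) * Real.Gamma ((N : ℝ) / 2 + q) *
      4 ^ ((N : ℝ) / 2 + q) * C * ‖x‖ ^ (-((N : ℝ) + 2 * q)) := by
  have hπ := Real.pi_pos
  have hx' : 0 < ‖x‖ := norm_pos_iff.2 hx
  obtain ⟨hint, heq⟩ := fourierInv_eq_integral_gaussKernel hm hη hmη hx
  obtain ⟨hJint, hJ⟩ := integral_rpow_mul_exp_neg_div (κ := (N : ℝ) / 2 + q) (ρ := ‖x‖ ^ 2 / 4)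
    (by positivity) (by positivity)
  rw [heq, Complex.norm_real]
  refine (norm_integral_le_of_norm_le
    (hJint.const_mul (C * (4 * Real.pi) ^ (-((N : ℝ) / 2)))) ?_).trans (le_of_eq ?_)
  · refine (ae_restrict_iff' measurableSet_Ioi).2 (Eventually.of_forall fun s hs => ?_)
    have hs' : (0 : ℝ) < s := hs
    rw [norm_mul, Real.norm_of_nonneg (gaussKernel_nonneg N hs' x), Real.norm_eq_abs]
    calc _ ≤ C * s ^ (-(q + 1)) * gaussKernel N s x := by
          have := gaussKernel_nonneg N hs' x
          gcongr
          exact hC s hs'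
      _ = _ := by
          rw [gaussKernel_eq N hs', show -((N : ℝ) / 2 + q + 1) = -(q + 1) + -((N : ℝ) / 2) by ring,
            Real.rpow_add hs']
          ring
  · rw [integral_const_mul, hJ, Real.div_rpow (by positivity) (by norm_num), ← Real.rpow_natCast,
      ← Real.rpow_mul hx'.le, Real.rpow_neg (by norm_num : (0 : ℝ) ≤ 4), div_inv_eq_mul,
      show ((2 : ℕ) : ℝ) * -((N : ℝ) / 2 + q) = -((N : ℝ) + 2 * q) by push_cast; ring]
    ring

/-- On the shell the exponent is at least `R²/(16s)`, and two exponents differ by at most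
`(3R/(4s))‖y - z‖`. Working with increments avoids differentiating under the subordination integral.
-/
theorem abs_gaussKernel_sub_le (N : ℕ) {s R : ℝ} (hs : 0 < s)
    {y z : EuclideanSpace ℝ (Fin N)} (hy : ‖y‖ ∈ Icc (R / 2) (3 * R / 2))
    (hz : ‖z‖ ∈ Icc (R / 2) (3 * R / 2)) (hR : 0 ≤ R) :
    |gaussKernel N s y - gaussKernel N s z| ≤ (4 * Real.pi) ^ (-((N : ℝ) / 2)) *
      (s ^ (-((N : ℝ) / 2)) * (Real.exp (-(R ^ 2 / 16 / s)) * (3 * R / 4 / s * ‖y - z‖))) := by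
  have hπ := Real.pi_pos
  have hexp : ∀ u v c : ℝ, c ≤ u → c ≤ v →
      |Real.exp (-u) - Real.exp (-v)| ≤ Real.exp (-c) * |u - v| := by
    intro u v c hu hv
    have hone : ∀ u v : ℝ, c ≤ u → u ≤ v →
        |Real.exp (-u) - Real.exp (-v)| ≤ Real.exp (-c) * |u - v| := by
      intro u v hu huv
      have h1 : Real.exp (-v) = Real.exp (-u) * Real.exp (u - v) := by
        rw [← Real.exp_add]; ring_nf
      have h2 := Real.add_one_le_exp (u - v)
      have h3 : Real.exp (-u) ≤ Real.exp (-c) := Real.exp_le_exp.2 (by linarith)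
      have h4 : Real.exp (-v) ≤ Real.exp (-u) := Real.exp_le_exp.2 (by linarith)
      rw [abs_of_nonneg (sub_nonneg.2 h4), abs_of_nonpos (by linarith), h1]
      have := Real.exp_pos (-u)
      calc _ = Real.exp (-u) * (1 - Real.exp (u - v)) := by ring
        _ ≤ Real.exp (-u) * -(u - v) := by gcongr; linarith
        _ ≤ _ := by gcongr; linarith
    rcases le_total u v with h | h
    · exact hone u v hu h
    · rw [abs_sub_comm, abs_sub_comm u v]
      exact hone v u hv h
  have hlow : ∀ w : EuclideanSpace ℝ (Fin N), ‖w‖ ∈ Icc (R / 2) (3 * R / 2) →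
      R ^ 2 / 16 / s ≤ ‖w‖ ^ 2 / 4 / s := by
    intro w hw
    have : (R / 2) ^ 2 ≤ ‖w‖ ^ 2 := by gcongr; exact hw.1
    refine div_le_div_of_nonneg_right ?_ hs.le
    linarith
  rw [gaussKernel_eq N hs, gaussKernel_eq N hs, ← mul_sub, ← mul_sub, abs_mul, abs_mul,
    abs_of_nonneg (by positivity), abs_of_nonneg (by positivity : 0 ≤ s ^ (-((N : ℝ) / 2)))]
  refine mul_le_mul_of_nonneg_left (mul_le_mul_of_nonneg_left
    ((hexp _ _ _ (hlow y hy) (hlow z hz)).trans ?_) (by positivity)) (by positivity)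
  refine mul_le_mul_of_nonneg_left ?_ (Real.exp_pos _).le
  have h1 : ‖y‖ ^ 2 / 4 / s - ‖z‖ ^ 2 / 4 / s = (‖y‖ + ‖z‖) * (‖y‖ - ‖z‖) / 4 / s := by ring
  have h2 := abs_norm_sub_norm_le y z
  rw [h1, abs_div, abs_div, abs_mul, abs_of_pos hs, abs_of_nonneg (by positivity : 0 ≤ ‖y‖ + ‖z‖),
    abs_of_pos (by norm_num : (0 : ℝ) < 4)]
  calc _ ≤ (3 * R) * ‖y - z‖ / 4 / s := by
        gcongr
        linarith [hy.2, hz.2]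
    _ = _ := by ring

/-- A Lipschitz constant on the ball of radius `‖x‖/2` bounds the derivative at its centre. Relative
to the bound for values, the increment brings a factor `R/s`: it raises `κ` by one and multiplies by
`R`, for a net gain of one power of `1/‖x‖`. -/
theorem norm_fderiv_fourierInv_le_rpow {N : ℕ} {m : EuclideanSpace ℝ (Fin N) → ℂ}
    (hm : Integrable m) {η : ℝ → ℝ} (hη : IntegrableOn η (Ioi 0))
    (hmη : ∀ ξ, ξ ≠ 0 →
      m ξ = ((∫ s in Ioi (0 : ℝ), η s * Real.exp (-(s * (2 * Real.pi * ‖ξ‖) ^ 2)) : ℝ) : ℂ))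
    {C q : ℝ} (hq : 0 < q) (hC : ∀ s : ℝ, 0 < s → |η s| ≤ C * s ^ (-(q + 1)))
    {x : EuclideanSpace ℝ (Fin N)} (hx : x ≠ 0) :
    ‖fderiv ℝ (𝓕⁻ m) x‖ ≤ (4 * Real.pi) ^ (-((N : ℝ) / 2)) * Real.Gamma ((N : ℝ) / 2 + q + 1) *
      (3 / 4) * 16 ^ ((N : ℝ) / 2 + q + 1) * C * ‖x‖ ^ (-((N : ℝ) + 2 * q + 1)) := by
  have hπ := Real.pi_pos
  set R := ‖x‖ with hRdef
  have hR : 0 < R := norm_pos_iff.2 hx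
  have hC0 : 0 ≤ C := by
    have := (abs_nonneg _).trans (hC 1 one_pos)
    simpa using this
  obtain ⟨hJint, hJ⟩ := integral_rpow_mul_exp_neg_div (κ := (N : ℝ) / 2 + q + 1) (ρ := R ^ 2 / 16)
    (by positivity) (by positivity)
  have hΓ := (Real.Gamma_pos_of_pos (show 0 < (N : ℝ) / 2 + q + 1 by positivity)).le
  have hconst : C * (4 * Real.pi) ^ (-((N : ℝ) / 2)) * (3 * R / 4) *
      (Real.Gamma ((N : ℝ) / 2 + q + 1) * (R ^ 2 / 16) ^ (-((N : ℝ) / 2 + q + 1)))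
      = (4 * Real.pi) ^ (-((N : ℝ) / 2)) * Real.Gamma ((N : ℝ) / 2 + q + 1) *
      (3 / 4) * 16 ^ ((N : ℝ) / 2 + q + 1) * C * R ^ (-((N : ℝ) + 2 * q + 1)) := by
    rw [Real.div_rpow (by positivity) (by norm_num), ← Real.rpow_natCast,
      ← Real.rpow_mul hR.le, Real.rpow_neg (by norm_num : (0 : ℝ) ≤ 16), div_inv_eq_mul,
      show -((N : ℝ) + 2 * q + 1) = 1 + ((2 : ℕ) : ℝ) * -((N : ℝ) / 2 + q + 1) by push_cast; ring,
      Real.rpow_add hR, Real.rpow_one]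
    ring
  set K := (4 * Real.pi) ^ (-((N : ℝ) / 2)) * Real.Gamma ((N : ℝ) / 2 + q + 1) *
      (3 / 4) * 16 ^ ((N : ℝ) / 2 + q + 1) * C * R ^ (-((N : ℝ) + 2 * q + 1)) with hK
  have hK0 : 0 ≤ K := by positivity
  have hball : Metric.ball x (R / 2) ∈ 𝓝 x := Metric.ball_mem_nhds x (by positivity)
  refine norm_fderiv_le_of_lipschitzOn (C := K.toNNReal) ℝ hball ?_ |>.trans_eq
    (Real.coe_toNNReal K hK0)
  have hshell : ∀ y ∈ Metric.ball x (R / 2), y ≠ 0 ∧ ‖y‖ ∈ Icc (R / 2) (3 * R / 2) := by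
    intro y hy
    rw [mem_ball_iff_norm] at hy
    have h1 := abs_le.1 ((abs_norm_sub_norm_le y x).trans hy.le)
    have h2 : R / 2 ≤ ‖y‖ := by linarith [h1.1]
    refine ⟨norm_pos_iff.1 (by linarith), h2, by linarith [h1.2]⟩
  refine LipschitzOnWith.of_dist_le_mul fun y hy z hz => ?_
  rw [Real.coe_toNNReal K hK0, dist_eq_norm, dist_eq_norm]
  obtain ⟨hy0, hyI⟩ := hshell y hy
  obtain ⟨hz0, hzI⟩ := hshell z hz
  obtain ⟨hyint, hyeq⟩ := fourierInv_eq_integral_gaussKernel hm hη hmη hy0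
  obtain ⟨hzint, hzeq⟩ := fourierInv_eq_integral_gaussKernel hm hη hmη hz0
  rw [hyeq, hzeq, ← Complex.ofReal_sub, Complex.norm_real, ← integral_sub hyint hzint]
  refine (norm_integral_le_of_norm_le
    (hJint.const_mul (C * (4 * Real.pi) ^ (-((N : ℝ) / 2)) * (3 * R / 4) * ‖y - z‖)) ?_).trans
    (le_of_eq ?_)
  · refine (ae_restrict_iff' measurableSet_Ioi).2 (Eventually.of_forall fun s hs => ?_)
    have hs' : (0 : ℝ) < s := hs
    rw [← mul_sub, norm_mul, Real.norm_eq_abs, Real.norm_eq_abs]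
    refine (mul_le_mul (hC s hs') (abs_gaussKernel_sub_le N hs' hyI hzI hR.le) (abs_nonneg _)
      (by positivity)).trans (le_of_eq ?_)
    rw [show -((N : ℝ) / 2 + q + 1 + 1) = -(q + 1) + -((N : ℝ) / 2) + -1 by ring,
      Real.rpow_add hs', Real.rpow_add hs', Real.rpow_neg_one]
    ring
  · rw [integral_const_mul, hJ, ← hconst]
    ring

end KernelBounds

/-! ### The kernels of the stable symbols: regularity, scaling and decay. -/

section FractionalSymbols

open MeasureTheory Set Filter Topology

/-- The symbol `|ξ|^p * exp (-t * |ξ|^σ)`, in the normalization `|ξ| ↦ 2π|ξ|`. -/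
noncomputable def stableSymbol (N : ℕ) (σ p t : ℝ) (ξ : EuclideanSpace ℝ (Fin N)) : ℝ :=
  (2 * Real.pi * ‖ξ‖) ^ p * Real.exp (-(2 * Real.pi * ‖ξ‖) ^ σ * t)

/-- The kernel with Fourier transform `stableSymbol N σ p t`. -/
noncomputable def stableKernel (N : ℕ) (σ p t : ℝ) : EuclideanSpace ℝ (Fin N) → ℂ :=
  𝓕⁻ (fun ξ : EuclideanSpace ℝ (Fin N) => ((stableSymbol N σ p t ξ : ℝ) : ℂ))

variable {N : ℕ} {σ p t : ℝ}

theorem stableSymbol_nonneg (ξ : EuclideanSpace ℝ (Fin N)) : 0 ≤ stableSymbol N σ p t ξ := by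
  have := Real.pi_pos
  unfold stableSymbol
  positivity

theorem measurable_stableSymbol : Measurable (stableSymbol N σ p t) := by
  unfold stableSymbol
  fun_prop

theorem exists_rpow_mul_exp_le {q : ℝ} (hq : 0 ≤ q) (hσ : 0 < σ) (ht : 0 < t) :
    ∃ D, 0 ≤ D ∧ ∀ y : ℝ, 0 ≤ y → y ^ q * Real.exp (-y ^ σ * t) ≤ D := by
  obtain ⟨D, hD0, hD⟩ := exists_exp_sub_exp_le hq hσ ht
  -- The extra one covers `y = 0`, where `0 ^ q` equals one if `q = 0`.
  refine ⟨D + 1, by linarith, fun y hy => ?_⟩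
  rcases hy.eq_or_lt with rfl | hy
  · have h1 : (0 : ℝ) ^ q ≤ 1 := Real.zero_rpow_le_one q
    rw [Real.zero_rpow hσ.ne', neg_zero, zero_mul, Real.exp_zero, mul_one]
    linarith
  · refine le_trans (le_of_eq ?_) ((hD (Real.log y)).trans (by linarith))
    rw [sub_eq_add_neg, Real.exp_add, Real.rpow_def_of_pos hy, Real.rpow_def_of_pos hy,
      mul_comm q, mul_comm σ]
    congr 2
    ring

theorem integrable_stableSymbol (hσ : 0 < σ) (hp : 0 ≤ p) (ht : 0 < t) :
    Integrable (stableSymbol N σ p t) := by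
  have hπ := Real.pi_gt_three
  obtain ⟨D₁, hD₁, h1⟩ := exists_rpow_mul_exp_le (q := p) hp hσ ht
  obtain ⟨D₂, hD₂, h2⟩ := exists_rpow_mul_exp_le (q := p + ((N : ℝ) + 1)) (by positivity) hσ ht
  have hint := (integrable_one_add_norm (E := EuclideanSpace ℝ (Fin N)) (μ := volume)
    (r := (N : ℝ) + 1) (by simp)).const_mul (2 ^ ((N : ℝ) + 1) * (D₁ + D₂))
  refine hint.mono' measurable_stableSymbol.aestronglyMeasurable (Eventually.of_forall fun ξ => ?_)
  rw [Real.norm_of_nonneg (stableSymbol_nonneg ξ), Real.rpow_neg (by positivity),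
    ← div_eq_mul_inv, le_div_iff₀ (by positivity)]
  unfold stableSymbol
  have hy : ‖ξ‖ ≤ 2 * Real.pi * ‖ξ‖ := by
    have := norm_nonneg ξ
    nlinarith
  have hy0 : 0 ≤ 2 * Real.pi * ‖ξ‖ := by positivity
  set y := 2 * Real.pi * ‖ξ‖
  have h1' := h1 y hy0
  have h2' := h2 y hy0
  have hE : 0 ≤ y ^ p * Real.exp (-y ^ σ * t) := by positivity
  have h3 : (1 + ‖ξ‖) ^ ((N : ℝ) + 1) ≤ 2 ^ ((N : ℝ) + 1) * (1 + y ^ ((N : ℝ) + 1)) := by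
    have hN : (0 : ℝ) ≤ (N : ℝ) + 1 := by positivity
    have hmax : (max 1 y) ^ ((N : ℝ) + 1) ≤ 1 + y ^ ((N : ℝ) + 1) := by
      have := Real.rpow_nonneg hy0 ((N : ℝ) + 1)
      rcases le_total 1 y with h | h
      · rw [max_eq_right h]; linarith
      · rw [max_eq_left h, Real.one_rpow]; linarith
    calc (1 + ‖ξ‖) ^ ((N : ℝ) + 1) ≤ (2 * max 1 y) ^ ((N : ℝ) + 1) := by
          refine Real.rpow_le_rpow (by positivity) ?_ hN
          linarith [le_max_left 1 y, le_max_right 1 y]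
      _ = 2 ^ ((N : ℝ) + 1) * (max 1 y) ^ ((N : ℝ) + 1) :=
          Real.mul_rpow (by norm_num) (by positivity)
      _ ≤ _ := by gcongr
  have hN1 : (N : ℝ) + 1 ≠ 0 := by positivity
  rw [Real.rpow_add_of_nonneg hy0 hp (by positivity)] at h2'
  calc _ ≤ y ^ p * Real.exp (-y ^ σ * t) * (2 ^ ((N : ℝ) + 1) * (1 + y ^ ((N : ℝ) + 1))) := by
        gcongr
    _ = 2 ^ ((N : ℝ) + 1) * (y ^ p * Real.exp (-y ^ σ * t) +
        y ^ p * y ^ ((N : ℝ) + 1) * Real.exp (-y ^ σ * t)) := by ring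
    _ ≤ _ := by gcongr

/-- Substitute `ξ ↦ t^{1/σ} ξ`: the Jacobian gives the power `N`, the factor `|ξ|^p` the power `p`.
-/
theorem integral_stableSymbol_scaling (hσ : 0 < σ) (ht : 0 < t) :
    ∫ ξ, stableSymbol N σ p t ξ = (∫ ξ, stableSymbol N σ p 1 ξ) *
      (t ^ (1 / σ)) ^ (-((N : ℝ) + p)) := by
  have hR : 0 < t ^ (1 / σ) := Real.rpow_pos_of_pos ht _
  have hRσ : (t ^ (1 / σ)) ^ σ = t := by
    rw [← Real.rpow_mul ht.le, one_div_mul_cancel hσ.ne', Real.rpow_one]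
  set R := t ^ (1 / σ)
  have hπ := Real.pi_pos
  have h := Measure.integral_comp_smul (volume : Measure (EuclideanSpace ℝ (Fin N)))
    (stableSymbol N σ p 1) R
  have hpt : ∀ ξ : EuclideanSpace ℝ (Fin N),
      stableSymbol N σ p 1 (R • ξ) = R ^ p * stableSymbol N σ p t ξ := by
    intro ξ
    unfold stableSymbol
    rw [norm_smul, Real.norm_of_nonneg hR.le,
      show 2 * Real.pi * (R * ‖ξ‖) = R * (2 * Real.pi * ‖ξ‖) by ring,
      Real.mul_rpow hR.le (by positivity), Real.mul_rpow hR.le (by positivity), hRσ]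
    ring_nf
  simp_rw [hpt] at h
  rw [integral_const_mul, finrank_euclideanSpace_fin, smul_eq_mul,
    abs_of_pos (by positivity)] at h
  rw [neg_add, Real.rpow_add hR, Real.rpow_neg hR.le, Real.rpow_neg hR.le, Real.rpow_natCast]
  have : R ^ p ≠ 0 := (Real.rpow_pos_of_pos hR p).ne'
  field_simp at h ⊢
  linarith

theorem norm_stableKernel_le (x : EuclideanSpace ℝ (Fin N)) :
    ‖stableKernel N σ p t x‖ ≤ ∫ ξ, stableSymbol N σ p t ξ := by
  rw [stableKernel, Real.fourierInv_eq']
  refine (norm_integral_le_integral_norm _).trans (le_of_eq ?_)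
  congr 1
  ext ξ
  rw [norm_smul, Complex.norm_exp_ofReal_mul_I, one_mul, Complex.norm_real,
    Real.norm_of_nonneg (stableSymbol_nonneg ξ)]

/-- The symbol is even, so results on derivatives of the forward transform apply to the kernel. -/
theorem stableKernel_eq_fourier : stableKernel N σ p t =
    𝓕 (fun ξ : EuclideanSpace ℝ (Fin N) => ((stableSymbol N σ p t ξ : ℝ) : ℂ)) := by
  rw [stableKernel, Real.fourierInv_eq_fourier_comp_neg]
  simp [stableSymbol]

theorem stableKernel_im (x : EuclideanSpace ℝ (Fin N)) : (stableKernel N σ p t x).im = 0 := by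
  rw [← Complex.conj_eq_iff_im, stableKernel, Real.fourierInv_eq', ← integral_conj,
    ← integral_neg_eq_self]
  refine integral_congr_ae (Eventually.of_forall fun ξ => ?_)
  simp only [smul_eq_mul, map_mul, Complex.conj_ofReal, ← Complex.exp_conj, Complex.conj_I,
    inner_neg_left, stableSymbol, norm_neg]
  congr 2
  push_cast
  ring

theorem norm_mul_stableSymbol (hp : 0 ≤ p) (ξ : EuclideanSpace ℝ (Fin N)) :
    2 * Real.pi * ‖ξ‖ * stableSymbol N σ p t ξ = stableSymbol N σ (p + 1) t ξ := by
  have := Real.pi_pos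
  rw [stableSymbol, stableSymbol, Real.rpow_add_of_nonneg (by positivity) hp zero_le_one,
    Real.rpow_one]
  ring

theorem integrable_norm_mul_stableSymbol (hσ : 0 < σ) (hp : 0 ≤ p) (ht : 0 < t) :
    Integrable (fun ξ : EuclideanSpace ℝ (Fin N) => ‖ξ‖ * ‖((stableSymbol N σ p t ξ : ℝ) : ℂ)‖) := by
  have hπ := Real.pi_pos
  refine ((integrable_stableSymbol hσ (by linarith : 0 ≤ p + 1) ht).const_mul
    (2 * Real.pi)⁻¹).congr (Eventually.of_forall fun ξ => ?_)
  simp only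
  rw [← norm_mul_stableSymbol hp, Complex.norm_real, Real.norm_of_nonneg (stableSymbol_nonneg ξ)]
  field_simp

theorem differentiable_stableKernel (hσ : 0 < σ) (hp : 0 ≤ p) (ht : 0 < t) :
    Differentiable ℝ (stableKernel N σ p t) := by
  rw [stableKernel_eq_fourier]
  exact Real.differentiable_fourier (integrable_stableSymbol hσ hp ht).ofReal
    (integrable_norm_mul_stableSymbol hσ hp ht)

theorem norm_fderiv_stableKernel_le (hσ : 0 < σ) (hp : 0 ≤ p) (ht : 0 < t)
    (x : EuclideanSpace ℝ (Fin N)) :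
    ‖fderiv ℝ (stableKernel N σ p t) x‖ ≤ ∫ ξ, stableSymbol N σ (p + 1) t ξ := by
  have hπ := Real.pi_pos
  rw [stableKernel_eq_fourier, Real.fderiv_fourier (integrable_stableSymbol hσ hp ht).ofReal
    (integrable_norm_mul_stableSymbol hσ hp ht)]
  refine (VectorFourier.norm_fourierIntegral_le_integral_norm _ _ _ _ _).trans ?_
  refine integral_mono_of_nonneg (Eventually.of_forall fun ξ => norm_nonneg _)
    (integrable_stableSymbol hσ (by linarith) ht) (Eventually.of_forall fun ξ => ?_)
  refine (VectorFourier.norm_fourierSMulRight_le _ _ _).trans ?_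
  rw [← norm_mul_stableSymbol hp, Complex.norm_real, Real.norm_of_nonneg (stableSymbol_nonneg ξ)]
  refine mul_le_mul_of_nonneg_right (mul_le_mul_of_nonneg_right ?_ (norm_nonneg _))
    (stableSymbol_nonneg ξ)
  have : ‖innerSL ℝ (E := EuclideanSpace ℝ (Fin N))‖ ≤ 1 := norm_innerSL_le ℝ
  nlinarith

/-- Each time derivative multiplies the symbol by `-|ξ|^σ`. For times within `t/2` of `t`, the
differentiated symbol is dominated by its value at time `t/2`. -/
theorem hasDerivAt_stableKernel_time (hσ : 0 < σ) (hp : 0 ≤ p) (ht : 0 < t)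
    (x : EuclideanSpace ℝ (Fin N)) :
    HasDerivAt (fun τ => stableKernel N σ p τ x) (-stableKernel N σ (p + σ) t x) t := by
  have hπ := Real.pi_pos
  have hball : Metric.ball t (t / 2) ∈ 𝓝 t := Metric.ball_mem_nhds t (by positivity)
  have hmeas : ∀ p' τ : ℝ, AEStronglyMeasurable (fun ξ : EuclideanSpace ℝ (Fin N) =>
      Complex.exp (↑(2 * Real.pi * inner ℝ ξ x) * Complex.I) •
        ((stableSymbol N σ p' τ ξ : ℝ) : ℂ)) := by
    intro p' τ
    refine Measurable.aestronglyMeasurable ?_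
    have := measurable_stableSymbol (N := N) (σ := σ) (p := p') (t := τ)
    fun_prop
  have hsym : ∀ ξ : EuclideanSpace ℝ (Fin N), ∀ τ : ℝ,
      HasDerivAt (fun τ => stableSymbol N σ p τ ξ) (-stableSymbol N σ (p + σ) τ ξ) τ := by
    intro ξ τ
    unfold stableSymbol
    have h := (((hasDerivAt_id τ).const_mul (-(2 * Real.pi * ‖ξ‖) ^ σ)).exp).const_mul
      ((2 * Real.pi * ‖ξ‖) ^ p)
    refine h.congr_deriv ?_
    rw [Real.rpow_add_of_nonneg (by positivity) hp hσ.le]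
    simp only [id]
    ring
  have key := hasDerivAt_integral_of_dominated_loc_of_deriv_le (μ := volume)
    (F := fun τ (ξ : EuclideanSpace ℝ (Fin N)) =>
      Complex.exp (↑(2 * Real.pi * inner ℝ ξ x) * Complex.I) •
        ((stableSymbol N σ p τ ξ : ℝ) : ℂ))
    (F' := fun τ (ξ : EuclideanSpace ℝ (Fin N)) =>
      Complex.exp (↑(2 * Real.pi * inner ℝ ξ x) * Complex.I) •
        ((-stableSymbol N σ (p + σ) τ ξ : ℝ) : ℂ))
    (bound := stableSymbol N σ (p + σ) (t / 2)) hball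
    (Eventually.of_forall fun τ => hmeas p τ) ?_ ?_ ?_
    (integrable_stableSymbol hσ (by linarith) (by linarith)) ?_
  · have h2 := key.2
    simp only [Complex.ofReal_neg, smul_neg, integral_neg] at h2
    simpa only [stableKernel, Real.fourierInv_eq'] using h2
  · refine (integrable_stableSymbol hσ hp ht).mono' (hmeas p t) (Eventually.of_forall fun ξ => ?_)
    rw [norm_smul, Complex.norm_exp_ofReal_mul_I, one_mul, Complex.norm_real,
      Real.norm_of_nonneg (stableSymbol_nonneg ξ)]
  · simp only [Complex.ofReal_neg, smul_neg]
    exact (hmeas (p + σ) t).neg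
  · refine Eventually.of_forall fun ξ τ hτ => ?_
    rw [norm_smul, Complex.norm_exp_ofReal_mul_I, one_mul, Complex.norm_real, norm_neg,
      Real.norm_of_nonneg (stableSymbol_nonneg ξ)]
    have hτ' : t / 2 ≤ τ := by
      rw [Metric.mem_ball, Real.dist_eq] at hτ
      linarith [(abs_lt.1 hτ).1]
    unfold stableSymbol
    refine mul_le_mul_of_nonneg_left (Real.exp_le_exp.2 ?_) (by positivity)
    have : 0 ≤ (2 * Real.pi * ‖ξ‖) ^ σ := by positivity
    nlinarith
  · exact Eventually.of_forall fun ξ τ _ => ((hsym ξ τ).ofReal_comp).fun_const_smul _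

theorem symbol_variable (ξ : EuclideanSpace ℝ (Fin N)) (c : ℝ) :
    ((2 * Real.pi * ‖ξ‖) ^ 2) ^ (c / 2) = (2 * Real.pi * ‖ξ‖) ^ c := by
  have := Real.pi_pos
  rw [← Real.rpow_natCast, ← Real.rpow_mul (by positivity)]
  congr 1
  push_cast
  ring

/-- Decay of the kernels in space, uniformly in time. -/
theorem exists_stableKernel_space_decay (N : ℕ) (hσ₀ : 0 < σ) (hσ₂ : σ < 2) (hp : 0 < p) :
    ∃ B : ℝ, 0 ≤ B ∧ ∀ t : ℝ, 0 < t → ∀ x : EuclideanSpace ℝ (Fin N), x ≠ 0 →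
      ‖stableKernel N σ p t x‖ ≤ B * ‖x‖ ^ (-((N : ℝ) + p)) ∧
      ‖fderiv ℝ (stableKernel N σ p t) x‖ ≤ B * ‖x‖ ^ (-((N : ℝ) + p + 1)) := by
  have hπ := Real.pi_pos
  obtain ⟨C, hC0, hC⟩ := exists_density (a := σ / 2) (q := p / 2) (by linarith) (by linarith)
    (by linarith)
  have hΓ1 := (Real.Gamma_pos_of_pos (show 0 < (N : ℝ) / 2 + p / 2 by positivity)).le
  have hΓ2 := (Real.Gamma_pos_of_pos (show 0 < (N : ℝ) / 2 + p / 2 + 1 by positivity)).le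
  refine ⟨max ((4 * Real.pi) ^ (-((N : ℝ) / 2)) * Real.Gamma ((N : ℝ) / 2 + p / 2) *
      4 ^ ((N : ℝ) / 2 + p / 2) * C) ((4 * Real.pi) ^ (-((N : ℝ) / 2)) *
      Real.Gamma ((N : ℝ) / 2 + p / 2 + 1) * (3 / 4) * 16 ^ ((N : ℝ) / 2 + p / 2 + 1) * C),
    le_max_of_le_left (by positivity), fun t ht x hx => ?_⟩
  obtain ⟨η, hη, hηC, hL⟩ := hC t ht
  have hm := (integrable_stableSymbol (N := N) hσ₀ hp.le ht).ofReal (𝕜 := ℂ)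
  have hmη : ∀ ξ : EuclideanSpace ℝ (Fin N), ξ ≠ 0 → ((stableSymbol N σ p t ξ : ℝ) : ℂ) =
      ((∫ s in Ioi (0 : ℝ), η s * Real.exp (-(s * (2 * Real.pi * ‖ξ‖) ^ 2)) : ℝ) : ℂ) := by
    intro ξ hξ
    have : 0 < ‖ξ‖ := norm_pos_iff.2 hξ
    rw [hL _ (by positivity), symbol_variable, symbol_variable, stableSymbol]
    ring_nf
  have h1 := norm_fourierInv_le_rpow hm hη hmη (by linarith) hηC hx
  have h2 := norm_fderiv_fourierInv_le_rpow hm hη hmη (by linarith) hηC hx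
  rw [show 2 * (p / 2) = p by ring] at h1 h2
  exact ⟨h1.trans (by gcongr; exact le_max_left _ _), h2.trans (by gcongr; exact le_max_right _ _)⟩

/-- Integrability of `P_σ` is what licenses Fourier inversion. The case `p = 0` needs
`exists_density_zero`, whose rate `s^{-(σ/2+1)}` yields the integrable tail `|x|^{-(N+σ)}`;
dependence on `t` is harmless here. -/
theorem integrable_stableKernel_zero (N : ℕ) (hσ₀ : 0 < σ) (hσ₂ : σ < 2) (ht : 0 < t) :
    Integrable (stableKernel N σ 0 t) := by
  have hπ := Real.pi_pos
  obtain ⟨C, hC0, η, hη, hηC, hL⟩ := exists_density_zero (a := σ / 2) (by linarith) (by linarith) ht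
  have hm := (integrable_stableSymbol (N := N) hσ₀ le_rfl ht).ofReal (𝕜 := ℂ)
  have hmη : ∀ ξ : EuclideanSpace ℝ (Fin N), ξ ≠ 0 → ((stableSymbol N σ 0 t ξ : ℝ) : ℂ) =
      ((∫ s in Ioi (0 : ℝ), η s * Real.exp (-(s * (2 * Real.pi * ‖ξ‖) ^ 2)) : ℝ) : ℂ) := by
    intro ξ hξ
    have : 0 < ‖ξ‖ := norm_pos_iff.2 hξ
    rw [hL _ (by positivity), symbol_variable, stableSymbol, Real.rpow_zero, one_mul]
    ring_nf
  set B := (4 * Real.pi) ^ (-((N : ℝ) / 2)) * Real.Gamma ((N : ℝ) / 2 + σ / 2) *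
      4 ^ ((N : ℝ) / 2 + σ / 2) * C
  have hΓ1 := (Real.Gamma_pos_of_pos (show 0 < (N : ℝ) / 2 + σ / 2 by positivity)).le
  have hB : 0 ≤ B := by positivity
  set M := ∫ ξ, stableSymbol N σ 0 t ξ
  have hM : 0 ≤ M := integral_nonneg stableSymbol_nonneg
  have hint := (integrable_one_add_norm (E := EuclideanSpace ℝ (Fin N)) (μ := volume)
    (r := (N : ℝ) + σ) (by simpa using hσ₀)).const_mul ((M + B) * 2 ^ ((N : ℝ) + σ))
  refine hint.mono' (differentiable_stableKernel hσ₀ le_rfl ht).continuous.aestronglyMeasurable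
    (Eventually.of_forall fun x => ?_)
  have hκ : 0 ≤ (N : ℝ) + σ := by positivity
  rw [mul_assoc]
  rcases le_total ‖x‖ 1 with h | h
  · have h1 : 1 ≤ 2 ^ ((N : ℝ) + σ) * (1 + ‖x‖) ^ (-((N : ℝ) + σ)) := by
      rw [Real.rpow_neg (by positivity), ← div_eq_mul_inv, le_div_iff₀ (by positivity), one_mul]
      exact Real.rpow_le_rpow (by positivity) (by linarith) hκ
    calc _ ≤ M * 1 := by rw [mul_one]; exact norm_stableKernel_le x
      _ ≤ _ := by gcongr; linarith
  · have hx : x ≠ 0 := norm_pos_iff.1 (by linarith)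
    have h0 : 0 < ‖x‖ := by linarith
    have h1 := norm_fourierInv_le_rpow hm hη hmη (by linarith) hηC hx
    rw [show 2 * (σ / 2) = σ by ring] at h1
    refine h1.trans ?_
    have h2 : ‖x‖ ^ (-((N : ℝ) + σ)) ≤ 2 ^ ((N : ℝ) + σ) * (1 + ‖x‖) ^ (-((N : ℝ) + σ)) := by
      rw [Real.rpow_neg (by positivity), Real.rpow_neg (by positivity), ← div_eq_mul_inv,
        le_div_iff₀ (by positivity), inv_mul_le_iff₀ (by positivity), ← Real.mul_rpow h0.le two_pos.le]
      exact Real.rpow_le_rpow (by positivity) (by linarith) hκ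
    have : B ≤ M + B := by linarith
    gcongr

/-- Since `|Y|_σ` is at most twice the larger of `‖x‖` and `t^{1/σ}`, the hypothesis for whichever
dominates gives the parabolic bound. -/
theorem le_div_parabolicNorm_rpow {κ A B v : ℝ} (hκ : 0 < κ) (hA : 0 ≤ A)
    (hB : 0 ≤ B) (ht : 0 < t) (x : EuclideanSpace ℝ (Fin N))
    (h1 : v ≤ A * (t ^ (1 / σ)) ^ (-κ)) (h2 : x ≠ 0 → v ≤ B * ‖x‖ ^ (-κ)) :
    v ≤ (A + B) * 2 ^ κ / parabolicNorm σ x t ^ κ := by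
  have hT : 0 < t ^ (1 / σ) := Real.rpow_pos_of_pos ht _
  have hTT : |t| ^ (2 / σ) = (t ^ (1 / σ)) ^ 2 := by
    rw [abs_of_pos ht, ← Real.rpow_natCast, ← Real.rpow_mul ht.le]
    congr 1
    push_cast
    ring
  rw [parabolicNorm, hTT]
  set T := t ^ (1 / σ)
  have hY : 0 < Real.sqrt (‖x‖ ^ 2 + T ^ 2) := Real.sqrt_pos.2 (by positivity)
  have key : ∀ r : ℝ, 0 < r → ‖x‖ ≤ r → T ≤ r →
      r ^ (-κ) ≤ 2 ^ κ / Real.sqrt (‖x‖ ^ 2 + T ^ 2) ^ κ := by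
    intro r hr hx hTr
    have hle : Real.sqrt (‖x‖ ^ 2 + T ^ 2) ≤ 2 * r := by
      refine Real.sqrt_le_iff.2 ⟨by positivity, ?_⟩
      have := norm_nonneg x
      nlinarith
    rw [Real.rpow_neg hr.le, le_div_iff₀ (by positivity), inv_mul_le_iff₀ (by positivity),
      ← Real.mul_rpow hr.le two_pos.le, mul_comm]
    exact Real.rpow_le_rpow hY.le hle hκ.le
  rw [mul_div_assoc]
  rcases le_total ‖x‖ T with h | h
  · refine h1.trans ?_
    have := key T hT h le_rfl
    have hAB : A ≤ A + B := by linarith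
    gcongr
  · have hx : 0 < ‖x‖ := hT.trans_le h
    refine (h2 (norm_pos_iff.1 hx)).trans ?_
    have := key ‖x‖ hx le_rfl h
    have hAB : B ≤ A + B := by linarith
    gcongr

/-- The kernels obey the parabolic decay estimates. -/
theorem exists_stableKernel_parabolic_decay (N : ℕ) (hσ₀ : 0 < σ) (hσ₂ : σ < 2) (hp : 0 < p) :
    ∃ c : ℝ, 0 ≤ c ∧ ∀ (x : EuclideanSpace ℝ (Fin N)) (t : ℝ), 0 < t →
      ‖stableKernel N σ p t x‖ ≤ c / parabolicNorm σ x t ^ ((N : ℝ) + p) ∧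
      ‖fderiv ℝ (stableKernel N σ p t) x‖ ≤ c / parabolicNorm σ x t ^ ((N : ℝ) + p + 1) := by
  obtain ⟨B, hB, hdecay⟩ := exists_stableKernel_space_decay N hσ₀ hσ₂ hp
  have hM : ∀ p', 0 ≤ ∫ ξ, stableSymbol N σ p' 1 ξ := fun p' => integral_nonneg stableSymbol_nonneg
  refine ⟨max (((∫ ξ, stableSymbol N σ p 1 ξ) + B) * 2 ^ ((N : ℝ) + p))
    (((∫ ξ, stableSymbol N σ (p + 1) 1 ξ) + B) * 2 ^ ((N : ℝ) + p + 1)),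
    le_max_of_le_left (mul_nonneg (add_nonneg (hM p) hB) (by positivity)), fun x t ht => ?_⟩
  have hY : 0 ≤ parabolicNorm σ x t := Real.sqrt_nonneg _
  constructor
  · refine (le_div_parabolicNorm_rpow (by positivity) (hM p) hB ht x ?_
      (fun hx => (hdecay t ht x hx).1)).trans (by gcongr; exact le_max_left _ _)
    exact (norm_stableKernel_le x).trans_eq (integral_stableSymbol_scaling hσ₀ ht)
  · refine (le_div_parabolicNorm_rpow (by positivity) (hM (p + 1)) hB ht x ?_
      (fun hx => (hdecay t ht x hx).2)).trans (by gcongr; exact le_max_right _ _)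
    refine (norm_fderiv_stableKernel_le hσ₀ hp.le ht x).trans_eq ?_
    rw [integral_stableSymbol_scaling hσ₀ ht, add_assoc]

theorem fracHeatKernel_eq : (fun y => fracHeatKernel N σ y t) = stableKernel N σ 0 t := by
  ext y
  simp [fracHeatKernel, stableKernel, stableSymbol]

theorem fourier_fracHeatKernel (hσ₀ : 0 < σ) (hσ₂ : σ < 2) (ht : 0 < t) :
    (fun ξ : EuclideanSpace ℝ (Fin N) => (((2 * Real.pi * ‖ξ‖) ^ σ : ℝ) : ℂ) *
      𝓕 (fun y => fracHeatKernel N σ y t) ξ) = fun ξ => ((stableSymbol N σ σ t ξ : ℝ) : ℂ) := by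
  have hcont : Continuous (fun ξ : EuclideanSpace ℝ (Fin N) =>
      ((stableSymbol N σ 0 t ξ : ℝ) : ℂ)) := by
    unfold stableSymbol
    simp only [Real.rpow_zero, one_mul]
    refine Complex.continuous_ofReal.comp (Real.continuous_exp.comp (Continuous.mul ?_ (by fun_prop)))
    exact (Continuous.rpow_const (by fun_prop) fun _ => Or.inr hσ₀.le).neg
  have h := hcont.fourier_fourierInv_eq (integrable_stableSymbol hσ₀ le_rfl ht).ofReal
    (by rw [← stableKernel_eq_fourier]; exact integrable_stableKernel_zero N hσ₀ hσ₂ ht)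
  ext ξ
  rw [fracHeatKernel_eq, stableKernel, h, ← Complex.ofReal_mul]
  simp [stableSymbol]

theorem singularKernel_eq (hσ₀ : 0 < σ) (hσ₂ : σ < 2) (ht : 0 < t)
    (x : EuclideanSpace ℝ (Fin N)) : singularKernel N σ x t = stableKernel N σ σ t x := by
  rw [singularKernel, fracLaplacian, fourier_fracHeatKernel hσ₀ hσ₂ ht, stableKernel]

end FractionalSymbols

/-! ### The estimates for the singular kernel. -/

theorem mainTheorem12 (N : ℕ) (hN : 1 ≤ N) (σ : ℝ) (hσ₀ : 0 < σ) (hσ₂ : σ < 2) :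
    ∃ c : ℝ, 0 < c ∧ ∀ (x : EuclideanSpace ℝ (Fin N)) (t : ℝ), 0 < t →
      FracLaplacianConverges σ (fun y => fracHeatKernel N σ y t) ∧
      (singularKernel N σ x t).im = 0 ∧
      DifferentiableAt ℝ (fun τ => singularKernel N σ x τ) t ∧
      DifferentiableAt ℝ (fun y => singularKernel N σ y t) x ∧
      ‖singularKernel N σ x t‖ ≤ c / parabolicNorm σ x t ^ ((N : ℝ) + σ) ∧
      ‖deriv (fun τ => singularKernel N σ x τ) t‖
        ≤ c / parabolicNorm σ x t ^ ((N : ℝ) + 2 * σ) ∧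
      ‖fderiv ℝ (fun y => singularKernel N σ y t) x‖
        ≤ c / parabolicNorm σ x t ^ ((N : ℝ) + σ + 1) := by
  obtain ⟨c₁, hc₁, h1⟩ := exists_stableKernel_parabolic_decay N hσ₀ hσ₂ hσ₀
  obtain ⟨c₂, hc₂, h2⟩ := exists_stableKernel_parabolic_decay N hσ₀ hσ₂
    (show 0 < σ + σ by linarith)
  -- The exponents `p = σ` (for `A` and its gradient) and `p = 2σ` (for `∂ₜA`) each bring a
  -- nonnegative constant; adding one makes the sum positive.
  refine ⟨c₁ + c₂ + 1, by linarith, fun x t ht => ?_⟩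
  have hY : 0 ≤ parabolicNorm σ x t := Real.sqrt_nonneg _
  have hspace : (fun y => singularKernel N σ y t) = stableKernel N σ σ t :=
    funext fun y => singularKernel_eq hσ₀ hσ₂ ht y
  have htime : HasDerivAt (fun τ => singularKernel N σ x τ)
      (-stableKernel N σ (σ + σ) t x) t := by
    refine (hasDerivAt_stableKernel_time hσ₀ hσ₀.le ht x).congr_of_eventuallyEq ?_
    -- The identification with `stableKernel` is available only at positive times, which suffices
    -- near `t`.
    filter_upwards [eventually_gt_nhds ht] with τ hτ
    exact singularKernel_eq hσ₀ hσ₂ hτ x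
  refine ⟨⟨?_, ?_⟩, ?_, htime.differentiableAt, ?_, ?_, ?_, ?_⟩
  · rw [fracHeatKernel_eq]
    exact integrable_stableKernel_zero N hσ₀ hσ₂ ht
  · rw [fourier_fracHeatKernel hσ₀ hσ₂ ht]
    exact (integrable_stableSymbol hσ₀ hσ₀.le ht).ofReal
  · rw [singularKernel_eq hσ₀ hσ₂ ht, stableKernel_im]
  · rw [hspace]
    exact differentiable_stableKernel hσ₀ hσ₀.le ht x
  · rw [singularKernel_eq hσ₀ hσ₂ ht]
    exact (h1 x t ht).1.trans (by gcongr; linarith)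
  · rw [htime.deriv, norm_neg, two_mul]
    exact (h2 x t ht).1.trans (by gcongr; linarith)
  · rw [hspace]
    exact (h1 x t ht).2.trans (by gcongr; linarith)
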